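/- Throughout, $V=M\,\partial_x+N\,\partial_y$ denotes a real vector field that is analytic in a neighbourhood of the origin of $\mathbb R^2$. \textbf{Focus, center, parabolic contact.} The origin is a non-degenerate monodromic singularity of $V$ if $V(0,0)=0$ and the eigenvalues of $DV(0,0)$ have non-zero imaginary part. For small $x>0$, let $(P_V(x),0)$ be the first point at which the forward trajectory through $(x,0)$ returns to the positive $x$-axis. Such a singularity is a \emph{focus of order $k\in\mathbb N_0$} if $P_V(x)=x+\alpha x^{2k+1}+o(x^{2k+1})$ as $x\to0^+$ with $\alpha\neq0$, and a \emph{center} if $P_V(x)=x$ for all small $x>0$. The field $V$ has a \emph{parabolic contact} (with $\{y=0\}$) at the origin if $N(0,0)=0$ and $M(0,0)\cdot\partial_xN(0,0)>0$. \textbf{Pseudo focus.} Let $V_i=M_i\,\partial_x+N_i\,\partial_y$ ($i=1,2$) satisfy $\operatorname{sgn}N_i(x,0)=\operatorname{sgn}x$ for all small $x\ne0$. The flow of the piecewise analytic field $V=\mathbf 1_{\{y>0\}}V_1+\mathbf 1_{\{y<0\}}V_2$ follows $V_1$ in $\{y>0\}$ and $V_2$ in $\{y<0\}$, and switches between them when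 it crosses the $x$-axis. Its first return map $P$ sends a small $x>0$ to the $b>0$ for which the trajectory of $V_1$ from $(x,0)$ runs through $\{y>0\}$ to a point $(c,0)$ with $c<0$, and the trajectory of $V_2$ from $(c,0)$ runs through $\{y<0\}$ to $(b,0)$. The field $V$ has a \emph{pseudo focus of order $n$} at the origin if $P$ is defined for all small $x>0$ and $P(x)=x+\alpha x^n+o(x^n)$ as $x\to0^+$ with $\alpha\ne0$. \textbf{Theorem.} Let $k\in\mathbb N_0$ and $n\in\mathbb N=\{1,2,\dots\}$. There exist analytic vector fields $V_1$, with a focus of order $k$ at the origin, and $V_2$, with a parabolic contact or a center at the origin, such that the piecewise analytic vector field $V=\mathbf 1_{\{y>0\}}V_1+\mathbf 1_{\{y<0\}}V_2$ has a pseudo focus of order $n$ at the origin, if and only if $n=2k+1$, or $n$ is even and $n<2k+1$. -/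

import Mathlib

open Filter Topology Asymptotics

/-- `γ` is a forward trajectory, on the time interval `[0, T]`, of the planar vector field
`V = (M, N)`, i.e. of the system `x' = M(x, y)`, `y' = N(x, y)`.
Vector fields are total functions; only their germ at the origin matters below. -/
def IsTrajectory (V : ℝ × ℝ → ℝ × ℝ) (γ : ℝ → ℝ × ℝ) (T : ℝ) : Prop :=
  ∀ t ∈ Set.Icc 0 T, HasDerivWithinAt γ (V (γ t)) (Set.Icc 0 T) t

/-- The forward trajectory of `V` through `(a, 0)` returns to the positive `x`-axis
for the first time at `(b, 0)`. -/
def FirstReturn (V : ℝ × ℝ → ℝ × ℝ) (a b : ℝ) : Prop :=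
  0 < a ∧ 0 < b ∧ ∃ (γ : ℝ → ℝ × ℝ) (T : ℝ), 0 < T ∧ IsTrajectory V γ T ∧
    γ 0 = (a, 0) ∧ γ T = (b, 0) ∧
    ∀ t ∈ Set.Ioo 0 T, ¬ (0 < (γ t).1 ∧ (γ t).2 = 0)

/-- The forward trajectory of `V` through `(a, 0)` runs through the open upper half plane until
it hits the `x`-axis at `(b, 0)`. -/
def UpperTransition (V : ℝ × ℝ → ℝ × ℝ) (a b : ℝ) : Prop :=
  ∃ (γ : ℝ → ℝ × ℝ) (T : ℝ), 0 < T ∧ IsTrajectory V γ T ∧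
    γ 0 = (a, 0) ∧ γ T = (b, 0) ∧ ∀ t ∈ Set.Ioo 0 T, 0 < (γ t).2

/-- The forward trajectory of `V` through `(a, 0)` runs through the open lower half plane until
it hits the `x`-axis at `(b, 0)`. -/
def LowerTransition (V : ℝ × ℝ → ℝ × ℝ) (a b : ℝ) : Prop :=
  ∃ (γ : ℝ → ℝ × ℝ) (T : ℝ), 0 < T ∧ IsTrajectory V γ T ∧
    γ 0 = (a, 0) ∧ γ T = (b, 0) ∧ ∀ t ∈ Set.Ioo 0 T, (γ t).2 < 0

/-- First return to the positive `x`-axis, in counter-clockwise direction, of the flow of the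
piecewise field equal to `V₁` in `{y > 0}` and to `V₂` in `{y < 0}`: the flow follows `V₁`
from `(a, 0)` through the upper half plane to some `(c, 0)` with `c < 0`, switches, and follows
`V₂` from `(c, 0)` through the lower half plane to `(b, 0)`. -/
def GluedFirstReturn (V₁ V₂ : ℝ × ℝ → ℝ × ℝ) (a b : ℝ) : Prop :=
  0 < a ∧ 0 < b ∧ ∃ c < 0, UpperTransition V₁ a c ∧ LowerTransition V₂ c b

/-- The relation `R` is, near `0⁺`, given by a map `P` with
`P(x) = x + α xⁿ + o(xⁿ)` as `x → 0⁺`, where `α ≠ 0`. -/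
def HasDisplacementOrder (R : ℝ → ℝ → Prop) (n : ℕ) : Prop :=
  ∃ P : ℝ → ℝ, (∀ᶠ x in 𝓝[>] (0 : ℝ), R x (P x)) ∧
    ∃ α : ℝ, α ≠ 0 ∧ (fun x => P x - x - α * x ^ n) =o[𝓝[>] 0] (fun x => x ^ n)

/-- Non-degenerate monodromic singularity at the origin: `V` vanishes there and all complex
eigenvalues of its linear part have non-zero imaginary part. -/
def HasNondegenerateMonodromicSingularity (V : ℝ × ℝ → ℝ × ℝ) : Prop :=
  V 0 = 0 ∧ ∀ z : ℂ,
    Polynomial.aeval z (fderiv ℝ V 0 : ℝ × ℝ →ₗ[ℝ] ℝ × ℝ).charpoly = 0 → z.im ≠ 0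

/-- (Non-degenerate) focus of order `k` at the origin: the first return map satisfies
`P(x) = x + α x^(2k+1) + o(x^(2k+1))` with `α ≠ 0`. -/
def HasFocusOfOrder (V : ℝ × ℝ → ℝ × ℝ) (k : ℕ) : Prop :=
  HasNondegenerateMonodromicSingularity V ∧ HasDisplacementOrder (FirstReturn V) (2 * k + 1)

/-- (Non-degenerate) center at the origin: the first return map is the identity. -/
def HasCenter (V : ℝ × ℝ → ℝ × ℝ) : Prop :=
  HasNondegenerateMonodromicSingularity V ∧ ∀ᶠ x in 𝓝[>] (0 : ℝ), FirstReturn V x x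

/-- Parabolic (second order) contact of `V = (M, N)` with the line `{y = 0}` at the origin:
`N(0,0) = 0` and `M(0,0) ∂ₓN(0,0) > 0`. -/
def HasParabolicContact (V : ℝ × ℝ → ℝ × ℝ) : Prop :=
  (V (0, 0)).2 = 0 ∧ 0 < (V (0, 0)).1 * deriv (fun x : ℝ => (V (x, 0)).2) 0

/-- The `x`-axis is crossed counter-clockwise around the origin: `sgn N(x,0) = sgn x` for all
small `x ≠ 0`. -/
def CrossesCounterclockwise (V : ℝ × ℝ → ℝ × ℝ) : Prop :=
  ∀ᶠ x in 𝓝[≠] (0 : ℝ), SignType.sign (V (x, 0)).2 = SignType.sign x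

/-- The piecewise field equal to `V₁` in `{y > 0}` and to `V₂` in `{y < 0}` has a pseudo focus
of order `n` at the origin, with counter-clockwise flow. -/
def HasPseudoFocusOfOrder (V₁ V₂ : ℝ × ℝ → ℝ × ℝ) (n : ℕ) : Prop :=
  CrossesCounterclockwise V₁ ∧ CrossesCounterclockwise V₂ ∧
    HasDisplacementOrder (GluedFirstReturn V₁ V₂) n

/-! Let `φ₁` be the half return map of `V₁`, defined on both sides of the origin, so that the first
return map of `V₁` is `φ₁ ∘ φ₁`. The passage of `V₂` through the lower half plane is the restriction
of an involution `φ₂` with slope -1 at 0, and the glued return map is `φ₂ ∘ φ₁`. Suppose it equals x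
+ α xⁿ + ⋯ with n ≥ 2. Applying `φ₂` gives φ₁ = φ₂(x + α xⁿ + ⋯) = φ₂ - α xⁿ + ⋯, and substituting
`φ₁` gives φ₁ ∘ φ₁ = x + α (1 - (-1)ⁿ) xⁿ + ⋯. For odd n the coefficient is 2α ≠ 0, so n must be the
order 2k+1 of the focus. For even n it vanishes, so the order of the focus lies beyond n. For n = 1
it suffices to compare slopes. This is `comp_self_of_comp_involution` and
`order_of_involution_comp`.

The involution has two sources. For a center `φ₂` is the half return map, whose square is the first
return map, hence the identity. A parabolic contact is unfolded by (x, y) ↦ (x, -y²): the pulled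
back field is monodromic and reversible under y ↦ -y, so its half return map is an involution
(`HasParabolicContact.exists_isLowerInvolution`).

Only jets of the half return maps are needed. `exists_halfReturn` produces them in polar
coordinates: after dividing the radius by ε and by the solution of the linear radial equation, the
right hand side is O(ε), and repeated integration gives expansions in ε uniform in the angle. Both
signs of ε are admitted, so one expansion serves both half planes.

For the converse, `standardFocus` has an explicit half return map -(x + α x^(2k+1) + ⋯), and
`parabolicField` has a polynomial first integral whose involution is either x ↦ -x or a perturbation
of it at the prescribed even order. -/

/-! ### Calculus of expansions in a small parameter, uniform on a compact set. -/

/-- `φ` has Taylor polynomials of all orders at `0`. -/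
def HasTaylorPolynomials (φ : ℝ → ℝ) : Prop :=
  ∀ m : ℕ, ∃ p : Polynomial ℝ, (fun x => φ x - p.eval x) =O[𝓝[≠] 0] fun x : ℝ => x ^ m

/-- `f ε θ = a₀ θ + a₁ θ ε + ⋯ + a_{m-1} θ ε^(m-1) + O(ε^m)` as `ε → 0`, uniformly for `θ ∈ S`,
with coefficients continuous on `S`. -/
def HasUnifExpansion (S : Set ℝ) : ℕ → (ℝ → ℝ → ℝ) → Prop
  | 0, f => ∃ C : ℝ, ∀ᶠ ε in 𝓝[≠] (0 : ℝ), ∀ θ ∈ S, |f ε θ| ≤ C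
  | m + 1, f => ∃ a : ℝ → ℝ, ContinuousOn a S ∧ ∃ g : ℝ → ℝ → ℝ, HasUnifExpansion S m g ∧
      ∀ᶠ ε in 𝓝[≠] (0 : ℝ), ∀ θ ∈ S, f ε θ = a θ + ε * g ε θ

namespace HasUnifExpansion

variable {S : Set ℝ} {m : ℕ} {f g : ℝ → ℝ → ℝ}

theorem congr (hf : HasUnifExpansion S m f)
    (h : ∀ᶠ ε in 𝓝[≠] (0 : ℝ), ∀ θ ∈ S, g ε θ = f ε θ) : HasUnifExpansion S m g := by
  cases m with
  | zero =>
    obtain ⟨C, hC⟩ := hf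
    refine ⟨C, ?_⟩
    filter_upwards [hC, h] with ε h1 h2 θ hθ
    rw [h2 θ hθ]; exact h1 θ hθ
  | succ m =>
    obtain ⟨a, ha, b, hb, hab⟩ := hf
    refine ⟨a, ha, b, hb, ?_⟩
    filter_upwards [hab, h] with ε h1 h2 θ hθ
    rw [h2 θ hθ]; exact h1 θ hθ

theorem of_continuousOn (hS : IsCompact S) {a : ℝ → ℝ} (ha : ContinuousOn a S) (m : ℕ) :
    HasUnifExpansion S m (fun _ θ => a θ) := by
  induction m generalizing a with
  | zero =>
    obtain ⟨C, hC⟩ := hS.exists_bound_of_continuousOn ha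
    exact ⟨C, Eventually.of_forall fun ε θ hθ => hC θ hθ⟩
  | succ m ih =>
    exact ⟨a, ha, fun _ _ => 0, ih (a := fun _ => 0) continuousOn_const, by simp⟩

theorem of_succ (hS : IsCompact S) (hf : HasUnifExpansion S (m + 1) f) :
    HasUnifExpansion S m f := by
  induction m generalizing f with
  | zero =>
    obtain ⟨a, ha, g, ⟨C, hC⟩, h⟩ := hf
    obtain ⟨A, hA⟩ := hS.exists_bound_of_continuousOn ha
    refine ⟨A + 1 * C, ?_⟩
    have h1 : ∀ᶠ ε in 𝓝[≠] (0 : ℝ), |ε| < 1 :=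
      (continuous_abs.tendsto' 0 0 abs_zero).eventually_lt_const one_pos |>.filter_mono
        nhdsWithin_le_nhds
    filter_upwards [hC, h, h1] with ε h2 h3 h1 θ hθ
    rw [h3 θ hθ]
    refine (abs_add_le _ _).trans (add_le_add (hA θ hθ) ?_)
    rw [abs_mul]
    exact mul_le_mul h1.le (h2 θ hθ) (abs_nonneg _) zero_le_one
  | succ m ih =>
    obtain ⟨a, ha, g, hg, h⟩ := hf
    exact ⟨a, ha, g, ih hg, h⟩

theorem add (hf : HasUnifExpansion S m f) (hg : HasUnifExpansion S m g) :
    HasUnifExpansion S m (fun ε θ => f ε θ + g ε θ) := by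
  induction m generalizing f g with
  | zero =>
    obtain ⟨C, hC⟩ := hf
    obtain ⟨D, hD⟩ := hg
    refine ⟨C + D, ?_⟩
    filter_upwards [hC, hD] with ε h1 h2 θ hθ
    exact (abs_add_le _ _).trans (add_le_add (h1 θ hθ) (h2 θ hθ))
  | succ m ih =>
    obtain ⟨a, ha, f', hf', h⟩ := hf
    obtain ⟨b, hb, g', hg', h'⟩ := hg
    refine ⟨fun θ => a θ + b θ, ha.add hb, _, ih hf' hg', ?_⟩
    filter_upwards [h, h'] with ε h1 h2 θ hθ
    rw [h1 θ hθ, h2 θ hθ]; ring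

theorem eps_mul (hf : HasUnifExpansion S m f) :
    HasUnifExpansion S (m + 1) (fun ε θ => ε * f ε θ) :=
  ⟨fun _ => 0, continuousOn_const, f, hf, by simp⟩

theorem mul (hS : IsCompact S) (hf : HasUnifExpansion S m f) (hg : HasUnifExpansion S m g) :
    HasUnifExpansion S m (fun ε θ => f ε θ * g ε θ) := by
  induction m generalizing f g with
  | zero =>
    obtain ⟨C, hC⟩ := hf
    obtain ⟨D, hD⟩ := hg
    refine ⟨C * D, ?_⟩
    filter_upwards [hC, hD] with ε h1 h2 θ hθ
    rw [abs_mul]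
    exact mul_le_mul (h1 θ hθ) (h2 θ hθ) (abs_nonneg _) ((abs_nonneg _).trans (h1 θ hθ))
  | succ m ih =>
    have hfm := hf.of_succ hS
    obtain ⟨a, ha, f', hf', h⟩ := hf
    obtain ⟨b, hb, g', hg', h'⟩ := hg
    refine ⟨fun θ => a θ * b θ, ha.mul hb, _,
      (ih (of_continuousOn hS hb m) hf').add (ih hfm hg'), ?_⟩
    filter_upwards [h, h'] with ε h1 h2 θ hθ
    simp only [h1 θ hθ, h2 θ hθ]; ring

theorem pow (hS : IsCompact S) (hf : HasUnifExpansion S m f) (j : ℕ) :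
    HasUnifExpansion S m (fun ε θ => f ε θ ^ j) := by
  induction j with
  | zero => simpa using of_continuousOn hS (a := fun _ => 1) continuousOn_const m
  | succ j ih => simpa only [pow_succ] using ih.mul hS hf

theorem sum (hS : IsCompact S) {ι : Type*} (s : Finset ι) {F : ι → ℝ → ℝ → ℝ}
    (hF : ∀ i ∈ s, HasUnifExpansion S m (F i)) :
    HasUnifExpansion S m (fun ε θ => ∑ i ∈ s, F i ε θ) := by
  classical
  induction s using Finset.induction_on with
  | empty => simpa using of_continuousOn hS (a := fun _ => 0) continuousOn_const m
  | insert i s hi ih =>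
    simp only [Finset.sum_insert hi]
    exact (hF i (by simp)).add (ih fun j hj => hF j (by simp [hj]))

/-- Induction on the order through 1/f = 1/a - ε · (1/a) · g · (1/f) for f = a + ε g: the factor ε
lets the right hand side use `1/f` to one order less. The lower bound on `|f|` passes to the leading
coefficient, which therefore has no zero. -/
theorem inv (hS : IsCompact S) (hf : HasUnifExpansion S m f) {c : ℝ} (hc : 0 < c)
    (hfc : ∀ᶠ ε in 𝓝[≠] (0 : ℝ), ∀ θ ∈ S, c ≤ |f ε θ|) :
    HasUnifExpansion S m (fun ε θ => (f ε θ)⁻¹) := by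
  induction m generalizing f with
  | zero =>
    refine ⟨c⁻¹, ?_⟩
    filter_upwards [hfc] with ε h θ hθ
    rw [abs_inv]
    exact inv_anti₀ hc (h θ hθ)
  | succ m ih =>
    have hfm := ih (hf.of_succ hS) hfc
    obtain ⟨a, ha, g, hg, h⟩ := hf
    -- An expansion of any order entails boundedness, by dropping to order 0.
    have hg0 : ∃ C : ℝ, ∀ᶠ ε in 𝓝[≠] (0 : ℝ), ∀ θ ∈ S, |g ε θ| ≤ C := by
      clear hfm h ih
      induction m with
      | zero => exact hg
      | succ m ih => exact ih (hg.of_succ hS)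
    obtain ⟨C, hC⟩ := hg0
    have hac : ∀ θ ∈ S, a θ ≠ 0 := by
      intro θ hθ h0
      have hlim : Tendsto (fun ε : ℝ => |ε| * C) (𝓝[≠] 0) (𝓝 0) :=
        ((continuous_abs.mul continuous_const).tendsto' 0 0 (by simp)).mono_left
          nhdsWithin_le_nhds
      have hle : ∀ᶠ ε in 𝓝[≠] (0 : ℝ), c ≤ |ε| * C := by
        filter_upwards [hfc, h, hC] with ε h1 h2 h3
        have := h1 θ hθ
        rw [h2 θ hθ, h0, zero_add, abs_mul] at this
        exact this.trans (mul_le_mul_of_nonneg_left (h3 θ hθ) (abs_nonneg _))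
      exact absurd (ge_of_tendsto hlim hle) (not_le.2 hc)
    have hainv : ContinuousOn (fun θ => (a θ)⁻¹) S := ha.inv₀ hac
    refine ⟨fun θ => (a θ)⁻¹, hainv, _,
      (of_continuousOn hS hainv.neg m).mul hS (hg.mul hS hfm), ?_⟩
    filter_upwards [h, hfc] with ε h1 h2 θ hθ
    have hf0 : f ε θ ≠ 0 := abs_pos.1 (hc.trans_le (h2 θ hθ))
    have ha0 := hac θ hθ
    have h1' := h1 θ hθ
    simp only [Pi.neg_apply]
    field_simp
    linarith

theorem of_bound {C : ℝ} (h : ∀ᶠ ε in 𝓝[≠] (0 : ℝ), ∀ θ ∈ S, |f ε θ| ≤ C * |ε| ^ m) :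
    HasUnifExpansion S m f := by
  induction m generalizing f with
  | zero => exact ⟨C, by simpa using h⟩
  | succ m ih =>
    refine ⟨fun _ => 0, continuousOn_const, fun ε θ => f ε θ / ε, ih ?_, ?_⟩
    · filter_upwards [h, self_mem_nhdsWithin] with ε h1 h2 θ hθ
      rw [abs_div, div_le_iff₀ (abs_pos.2 h2), mul_assoc, ← pow_succ]
      exact h1 θ hθ
    · filter_upwards [self_mem_nhdsWithin] with ε h2 θ _
      rw [zero_add, mul_div_cancel₀ _ h2]

/-- Integration acts coefficient by coefficient. The remainder stays integrable at each stage
because it is (f - a)/ε, a quotient of continuous functions for fixed ε ≠ 0. -/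
theorem integral {T : ℝ} (hf : HasUnifExpansion (Set.Icc 0 T) m f)
    (hc : ∀ᶠ ε in 𝓝[≠] (0 : ℝ), ContinuousOn (f ε) (Set.Icc 0 T)) :
    HasUnifExpansion (Set.Icc 0 T) m (fun ε θ => ∫ s in (0 : ℝ)..θ, f ε s) := by
  induction m generalizing f with
  | zero =>
    obtain ⟨C, hC⟩ := hf
    refine ⟨C * T, ?_⟩
    filter_upwards [hC] with ε h θ hθ
    have hC0 : 0 ≤ C := (abs_nonneg _).trans (h θ hθ)
    have := intervalIntegral.norm_integral_le_of_norm_le_const (a := 0) (b := θ) (f := f ε)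
      (C := C) (fun x hx => by
        rw [Set.uIoc_of_le hθ.1] at hx
        exact h x ⟨hx.1.le, hx.2.trans hθ.2⟩)
    rw [sub_zero, abs_of_nonneg hθ.1] at this
    exact this.trans (mul_le_mul_of_nonneg_left hθ.2 hC0)
  | succ m ih =>
    obtain ⟨a, ha, g, hg, h⟩ := hf
    have hgc : ∀ᶠ ε in 𝓝[≠] (0 : ℝ), ContinuousOn (g ε) (Set.Icc 0 T) := by
      filter_upwards [h, hc, self_mem_nhdsWithin] with ε h1 h2 h3
      refine ((h2.sub ha).div_const ε).congr fun θ hθ => ?_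
      simp only [Pi.sub_apply]
      rw [h1 θ hθ, add_sub_cancel_left, mul_div_cancel_left₀ _ h3]
    have hsub : ∀ θ ∈ Set.Icc 0 T, Set.uIcc 0 θ ⊆ Set.Icc 0 T := fun θ hθ => by
      rw [Set.uIcc_of_le hθ.1]; exact Set.Icc_subset_Icc_right hθ.2
    have haI : ∀ θ ∈ Set.Icc 0 T, IntervalIntegrable a MeasureTheory.volume 0 θ := fun θ hθ =>
      (ha.mono (hsub θ hθ)).intervalIntegrable
    refine ⟨fun θ => ∫ s in (0 : ℝ)..θ, a s, ?_, _, ih hg hgc, ?_⟩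
    · rcases le_or_gt 0 T with hT | hT
      · simpa [Set.uIcc_of_le hT] using
          intervalIntegral.continuousOn_primitive_interval' (haI T ⟨hT, le_rfl⟩) Set.left_mem_uIcc
      · rw [Set.Icc_eq_empty (not_le.2 hT)]; exact continuousOn_empty _
    · filter_upwards [h, hgc] with ε h1 h2 θ hθ
      rw [← intervalIntegral.integral_const_mul, ← intervalIntegral.integral_add (haI θ hθ)
        ((h2.mono (hsub θ hθ)).intervalIntegrable.const_mul ε)]
      exact intervalIntegral.integral_congr fun s hs => h1 s (hsub θ hθ hs)

theorem exists_polynomial (hf : HasUnifExpansion S m f) {θ : ℝ} (hθ : θ ∈ S) :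
    ∃ p : Polynomial ℝ, (fun ε => f ε θ - p.eval ε) =O[𝓝[≠] 0] fun ε : ℝ => ε ^ m := by
  induction m generalizing f with
  | zero =>
    obtain ⟨C, hC⟩ := hf
    refine ⟨0, IsBigO.of_bound C ?_⟩
    filter_upwards [hC] with ε h
    simpa using h θ hθ
  | succ m ih =>
    obtain ⟨a, -, g, hg, h⟩ := hf
    obtain ⟨p, hp⟩ := ih hg
    refine ⟨Polynomial.C (a θ) + Polynomial.X * p, ?_⟩
    have := (isBigO_refl (fun ε : ℝ => ε) (𝓝[≠] 0)).mul hp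
    refine this.congr' ?_ (Eventually.of_forall fun ε => (pow_succ' ε m).symm)
    filter_upwards [h] with ε h1
    rw [h1 θ hθ]
    simp only [Polynomial.eval_add, Polynomial.eval_C, Polynomial.eval_mul, Polynomial.eval_X]
    ring

end HasUnifExpansion

/-! ### Uniqueness of orbits and changes of time. -/

/-- Two solutions of `x' = g(s) V(x)` with the same initial value agree, if one of them stays in
an open set on which `V` is Lipschitz. -/
theorem eqOn_Icc_of_lipschitzOnWith {E : Type*} [NormedAddCommGroup E] [NormedSpace ℝ E]
    {V : E → E} {U : Set E} {K : NNReal} (hU : IsOpen U) (hV : LipschitzOnWith K V U)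
    {g : ℝ → ℝ} {σ : ℝ} (hg : ContinuousOn g (Set.Icc 0 σ)) {α β : ℝ → E}
    (hα : ContinuousOn α (Set.Icc 0 σ)) (hβ : ContinuousOn β (Set.Icc 0 σ))
    (hα' : ∀ s ∈ Set.Ico 0 σ, HasDerivWithinAt α (g s • V (α s)) (Set.Ici s) s)
    (hβ' : ∀ s ∈ Set.Ico 0 σ, HasDerivWithinAt β (g s • V (β s)) (Set.Ici s) s)
    (hβU : ∀ s ∈ Set.Icc 0 σ, β s ∈ U) (h0 : α 0 = β 0) :
    Set.EqOn α β (Set.Icc 0 σ) := by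
  obtain ⟨G, hG⟩ := isCompact_Icc.exists_bound_of_continuousOn hg
  have hclosed : IsClosed ({s | α s = β s} ∩ Set.Icc 0 σ) := by
    have := (hα.sub hβ).preimage_isClosed_of_isClosed isClosed_Icc (isClosed_singleton (x := 0))
    convert this using 1
    ext s
    simp [sub_eq_zero, and_comm]
  -- The set of agreement is closed, so it remains to extend it to the right. Only `β` is known to
  -- stay in `U`; near a point of agreement `α` stays there too by continuity, which is enough for
  -- local uniqueness.
  refine hclosed.Icc_subset_of_forall_mem_nhdsWithin h0 fun s ⟨hs, hsI⟩ => ?_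
  have hs' : s ∈ Set.Icc 0 σ := ⟨hsI.1, hsI.2.le⟩
  have hnear : ∀ᶠ r in 𝓝[>] s, r ≤ σ ∧ ∀ q ∈ Set.Icc s r, α q ∈ U := by
    have hIcc : Set.Icc s σ ∈ 𝓝[≥] s := Icc_mem_nhdsGE hsI.2
    have h1 : ∀ᶠ q in 𝓝[≥] s, α q ∈ U := by
      have hc : ContinuousWithinAt α (Set.Icc s σ) s :=
        (hα s hs').mono (Set.Icc_subset_Icc_left hsI.1)
      have hc' : ContinuousWithinAt α (Set.Ici s) s :=
        hc.mono_of_mem_nhdsWithin hIcc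
      exact hc' (hU.mem_nhds (by rw [show α s = β s from hs]; exact hβU s hs'))
    obtain ⟨u, hu, hsub⟩ := mem_nhdsGE_iff_exists_Icc_subset.1 (inter_mem h1 hIcc)
    filter_upwards [Ioc_mem_nhdsGT hu] with r hr
    exact ⟨(hsub ⟨hr.1.le, hr.2⟩).2.2, fun q hq => (hsub ⟨hq.1, hq.2.trans hr.2⟩).1⟩
  filter_upwards [hnear, self_mem_nhdsWithin] with r ⟨hrσ, hr⟩ (hsr : s < r)
  have hsubI : Set.Icc s r ⊆ Set.Icc 0 σ := Set.Icc_subset_Icc hsI.1 hrσ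
  have hsubI' : Set.Ico s r ⊆ Set.Ico 0 σ := Set.Ico_subset_Ico hsI.1 hrσ
  refine ODE_solution_unique_of_mem_Icc_right (v := fun q x => g q • V x) (s := fun _ => U)
    (K := Real.toNNReal G * K) (a := s) (b := r) ?_ (hα.mono hsubI)
    (fun q hq => hα' q (hsubI' hq)) (fun q hq => hr q ⟨hq.1, hq.2.le⟩) (hβ.mono hsubI)
    (fun q hq => hβ' q (hsubI' hq)) (fun q hq => hβU q (hsubI ⟨hq.1, hq.2.le⟩)) hs
    (Set.right_mem_Icc.2 hsr.le)
  intro q hq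
  refine LipschitzOnWith.of_dist_le_mul fun x hx y hy => ?_
  rw [dist_smul₀, NNReal.coe_mul, mul_assoc]
  refine mul_le_mul ?_ (hV.dist_le_mul x hx y hy) dist_nonneg (NNReal.coe_nonneg _)
  exact (hG q (hsubI ⟨hq.1, hq.2.le⟩)).trans (Real.le_coe_toNNReal G)

/-- `Γ` parametrizes, on `[0, τ]`, an orbit of `V` with speed factor `g`, positive inside. -/
structure IsOrbit (V : ℝ × ℝ → ℝ × ℝ) (Γ : ℝ → ℝ × ℝ) (g : ℝ → ℝ) (τ : ℝ) : Prop where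
  continuousOn : ContinuousOn g (Set.Icc 0 τ)
  pos : ∀ s ∈ Set.Ioo 0 τ, 0 < g s
  hasDeriv : ∀ s ∈ Set.Icc 0 τ, HasDerivWithinAt Γ (g s • V (Γ s)) (Set.Icc 0 τ) s

namespace IsOrbit

variable {V : ℝ × ℝ → ℝ × ℝ} {Γ : ℝ → ℝ × ℝ} {g : ℝ → ℝ} {τ : ℝ}

/-- A trajectory starting on an orbit that stays in a region where `V` is Lipschitz follows
this orbit. -/
theorem exists_time (hΓ : IsOrbit V Γ g τ) (hτ : 0 < τ) {U : Set (ℝ × ℝ)} {K : NNReal}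
    (hU : IsOpen U) (hV : LipschitzOnWith K V U) (hΓU : ∀ s ∈ Set.Icc 0 τ, Γ s ∈ U)
    {γ : ℝ → ℝ × ℝ} {T : ℝ} (hγ : IsTrajectory V γ T) (h0 : γ 0 = Γ 0) :
    ∃ h : ℝ → ℝ, ContinuousOn h (Set.Icc 0 τ) ∧ StrictMonoOn h (Set.Icc 0 τ) ∧ h 0 = 0 ∧
      ∀ s ∈ Set.Icc 0 τ, h s ≤ T → γ (h s) = Γ s := by
  have hgi : IntervalIntegrable g MeasureTheory.volume 0 τ :=
    hΓ.continuousOn.intervalIntegrable_of_Icc hτ.le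
  -- The primitive of the speed factor is the elapsed time, so `γ ∘ h` and `Γ` solve the same
  -- equation. Positivity of `g` inside the interval already makes it strictly monotone; this
  -- matters for folded orbits, whose speed factor vanishes at the ends.
  set h : ℝ → ℝ := fun s => ∫ q in (0 : ℝ)..s, g q with hh
  have hcont : ContinuousOn h (Set.Icc 0 τ) := by
    simpa [Set.uIcc_of_le hτ.le] using
      intervalIntegral.continuousOn_primitive_interval' hgi Set.left_mem_uIcc
  have hder : ∀ s ∈ Set.Ico 0 τ, HasDerivWithinAt h (g s) (Set.Ici s) s := by
    intro s hs
    have hsub : Set.uIcc 0 s ⊆ Set.uIcc 0 τ := by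
      rw [Set.uIcc_of_le hs.1, Set.uIcc_of_le hτ.le]; exact Set.Icc_subset_Icc_right hs.2.le
    have hIcc : Set.Icc s τ ∈ 𝓝[≥] s := Icc_mem_nhdsGE hs.2
    have hc : ContinuousWithinAt g (Set.Ici s) s :=
      ((hΓ.continuousOn s ⟨hs.1, hs.2.le⟩).mono
        (Set.Icc_subset_Icc_left hs.1)).mono_of_mem_nhdsWithin hIcc
    refine intervalIntegral.integral_hasDerivWithinAt_right (hgi.mono_set hsub)
      (s := Set.Ici s) (t := Set.Ioi s) ?_ (hc.mono Set.Ioi_subset_Ici_self)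
    have hm := ContinuousOn.stronglyMeasurableAtFilter_nhdsWithin
      (hΓ.continuousOn.mono (Set.Icc_subset_Icc_left hs.1)) measurableSet_Icc s
      (μ := MeasureTheory.volume)
    refine hm.filter_mono ?_
    exact nhdsWithin_le_iff.2 (nhdsWithin_mono _ Set.Ioi_subset_Ici_self hIcc)
  have hmono : StrictMonoOn h (Set.Icc 0 τ) := by
    refine strictMonoOn_of_deriv_pos (convex_Icc 0 τ) hcont fun s hs => ?_
    rw [interior_Icc] at hs
    have hsI : s ∈ Set.Icc 0 τ := ⟨hs.1.le, hs.2.le⟩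
    have hnhds : Set.Icc 0 τ ∈ 𝓝 s := Icc_mem_nhds hs.1 hs.2
    have hsub : Set.uIcc 0 s ⊆ Set.uIcc 0 τ := by
      rw [Set.uIcc_of_le hs.1.le, Set.uIcc_of_le hτ.le]; exact Set.Icc_subset_Icc_right hs.2.le
    have := intervalIntegral.integral_hasDerivAt_right (hgi.mono_set hsub)
      ((hΓ.continuousOn.stronglyMeasurableAtFilter_nhdsWithin measurableSet_Icc s
        (μ := MeasureTheory.volume)).filter_mono (le_inf le_rfl (le_principal_iff.2 hnhds)))
      ((hΓ.continuousOn s hsI).continuousAt hnhds)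
    rw [this.deriv]
    exact hΓ.pos s hs
  have hh0 : h 0 = 0 := by simp [hh]
  refine ⟨h, hcont, hmono, hh0, fun σ hσ hσT => ?_⟩
  have hmaps : ∀ s ∈ Set.Icc 0 σ, h s ∈ Set.Icc 0 T := fun s hs => by
    have hsτ : s ∈ Set.Icc 0 τ := ⟨hs.1, hs.2.trans hσ.2⟩
    refine ⟨?_, (hmono.monotoneOn hsτ hσ hs.2).trans hσT⟩
    rw [← hh0]
    exact hmono.monotoneOn ⟨le_rfl, hτ.le⟩ hsτ hs.1
  have hsubσ : Set.Icc 0 σ ⊆ Set.Icc 0 τ := Set.Icc_subset_Icc_right hσ.2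
  refine eqOn_Icc_of_lipschitzOnWith (α := fun s => γ (h s)) hU hV
    (hΓ.continuousOn.mono hsubσ) ?_ ?_ ?_ ?_ (fun s hs => hΓU s (hsubσ hs)) (by simp [hh0, h0])
    ⟨hσ.1, le_rfl⟩
  · exact ContinuousOn.comp (t := Set.Icc 0 T) (fun t ht => (hγ t ht).continuousWithinAt)
      (hcont.mono hsubσ) hmaps
  · exact fun s hs => ((hΓ.hasDeriv s (hsubσ hs)).continuousWithinAt).mono hsubσ
  · intro s hs
    have hsI : s ∈ Set.Icc 0 σ := ⟨hs.1, hs.2.le⟩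
    have hsσ : Set.Icc s σ ∈ 𝓝[≥] s := Icc_mem_nhdsGE hs.2
    have h1 : HasDerivWithinAt h (g s) (Set.Icc s σ) s :=
      (hder s ⟨hs.1, hs.2.trans_le hσ.2⟩).mono Set.Icc_subset_Ici_self
    exact ((hγ (h s) (hmaps s hsI)).scomp s h1
      (fun q hq => hmaps q ⟨hs.1.trans hq.1, hq.2⟩)).mono_of_mem_nhdsWithin hsσ
  · intro s hs
    have hsI : s ∈ Set.Icc 0 σ := ⟨hs.1, hs.2.le⟩
    have hsσ : Set.Icc s σ ∈ 𝓝[≥] s := Icc_mem_nhdsGE hs.2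
    exact ((hΓ.hasDeriv s (hsubσ hsI)).mono ((Set.Icc_subset_Icc_left hs.1).trans
      hsubσ)).mono_of_mem_nhdsWithin hsσ

/-- A trajectory starting on an orbit that lies in a half plane either stops in the same half
plane or passes through the end point of the orbit. -/
theorem follow (hΓ : IsOrbit V Γ g τ) (hτ : 0 < τ) {U : Set (ℝ × ℝ)} {K : NNReal}
    (hU : IsOpen U) (hV : LipschitzOnWith K V U) (hΓU : ∀ s ∈ Set.Icc 0 τ, Γ s ∈ U) {σ : ℝ}
    (hpos : ∀ s ∈ Set.Ioo 0 τ, 0 < σ * (Γ s).2)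
    {γ : ℝ → ℝ × ℝ} {T : ℝ} (hT : 0 < T) (hγ : IsTrajectory V γ T) (h0 : γ 0 = Γ 0) :
    0 < σ * (γ T).2 ∨ ∃ t ∈ Set.Ioc 0 T, γ t = Γ τ := by
  obtain ⟨k, hkc, hkm, hk0, hk⟩ := hΓ.exists_time hτ hU hV hΓU hγ h0
  have hτI : τ ∈ Set.Icc 0 τ := ⟨hτ.le, le_rfl⟩
  have hkτ : 0 < k τ := by rw [← hk0]; exact hkm ⟨le_rfl, hτ.le⟩ hτI hτ
  rcases lt_or_ge T (k τ) with hlt | hge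
  · left
    obtain ⟨s, hs, rfl⟩ := intermediate_value_Icc hτ.le hkc (show T ∈ Set.Icc (k 0) (k τ) from
      ⟨by rw [hk0]; exact hT.le, hlt.le⟩)
    rw [hk s hs le_rfl]
    refine hpos s ⟨lt_of_le_of_ne hs.1 ?_, lt_of_le_of_ne hs.2 ?_⟩
    · rintro rfl; exact hT.ne' hk0
    · rintro rfl; exact lt_irrefl _ hlt
  · exact Or.inr ⟨k τ, ⟨hkτ, hge⟩, hk τ hτI hge⟩

/-- A trajectory ending on the axis cannot stop inside the half plane, so it passes through the end
of the orbit, and as it avoids the axis before time `T` this happens exactly at `T`. -/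
theorem eq_of_trajectory (hΓ : IsOrbit V Γ g τ) (hτ : 0 < τ) {U : Set (ℝ × ℝ)} {K : NNReal}
    (hU : IsOpen U) (hV : LipschitzOnWith K V U) (hΓU : ∀ s ∈ Set.Icc 0 τ, Γ s ∈ U) {σ : ℝ}
    (hpos : ∀ s ∈ Set.Ioo 0 τ, 0 < σ * (Γ s).2) (hend : (Γ τ).2 = 0)
    {γ : ℝ → ℝ × ℝ} {T : ℝ} (hT : 0 < T) (hγ : IsTrajectory V γ T) (h0 : γ 0 = Γ 0)
    (hγT : (γ T).2 = 0) (hne : ∀ t ∈ Set.Ioo 0 T, (γ t).2 ≠ 0) : γ T = Γ τ := by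
  rcases hΓ.follow hτ hU hV hΓU hpos hT hγ h0 with h1 | ⟨t, ht, h1⟩
  · simp [hγT] at h1
  · rcases ht.2.lt_or_eq with hlt | rfl
    · exact absurd (by rw [h1, hend]) (hne t ⟨ht.1, hlt⟩)
    · exact h1

/-- An orbit whose speed factor is positive up to the ends becomes a trajectory after a change of
time. -/
theorem exists_trajectory (hΓ : IsOrbit V Γ g τ) (hτ : 0 < τ) (hg : ∀ s ∈ Set.Icc 0 τ, 0 < g s) :
    ∃ (k : ℝ → ℝ) (T : ℝ), 0 < T ∧ IsTrajectory V (fun t => Γ (k t)) T ∧ k 0 = 0 ∧ k T = τ ∧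
      ∀ t ∈ Set.Ioo 0 T, k t ∈ Set.Ioo 0 τ := by
  -- Extending `g` by constants keeps it above its positive minimum, so its primitive is a bijection
  -- of the whole line and can be inverted globally.
  set G : ℝ → ℝ := Set.IccExtend hτ.le ((Set.Icc 0 τ).domRestrict g) with hG
  have hGc : Continuous G := (continuousOn_iff_continuous_domRestrict.1 hΓ.continuousOn).Icc_extend'
  have hGg : ∀ s ∈ Set.Icc 0 τ, G s = g s := fun s hs => Set.IccExtend_of_mem hτ.le _ hs
  obtain ⟨s₀, hs₀, hmin⟩ := isCompact_Icc.exists_isMinOn ⟨0, le_rfl, hτ.le⟩ hΓ.continuousOn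
  have hc : 0 < g s₀ := hg s₀ hs₀
  have hGmin : ∀ s, g s₀ ≤ G s := fun s => hmin (Set.projIcc 0 τ hτ.le s).2
  set h : ℝ → ℝ := fun s => ∫ q in (0 : ℝ)..s, G q with hh
  have hder : ∀ s, HasDerivAt h (G s) s := fun s => (hGc.integral_hasStrictDerivAt 0 s).hasDerivAt
  have hh0 : h 0 = 0 := by simp [hh]
  have hmono : StrictMono h := strictMono_of_deriv_pos fun s => by
    rw [(hder s).deriv]; exact hc.trans_le (hGmin s)
  have hcont : Continuous h := continuous_iff_continuousAt.2 fun s => (hder s).continuousAt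
  have hdiff : Monotone fun s => h s - g s₀ * s := by
    have hd : ∀ s, HasDerivAt (fun s => h s - g s₀ * s) (G s - g s₀ * 1) s := fun s =>
      (hder s).sub ((hasDerivAt_id s).const_mul _)
    refine monotone_of_deriv_nonneg (fun s => (hd s).differentiableAt) fun s => ?_
    rw [(hd s).deriv]
    linarith [hGmin s]
  have hsurj : Function.Surjective h := by
    refine hcont.surjective ?_ ?_
    · refine tendsto_atTop_mono' _ ?_ (tendsto_id.const_mul_atTop hc)
      filter_upwards [eventually_ge_atTop (0 : ℝ)] with s hs
      have := hdiff hs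
      simp only [hh0, mul_zero, sub_zero, id] at this ⊢
      linarith
    · refine tendsto_atBot_mono' _ ?_ (tendsto_id.const_mul_atBot hc)
      filter_upwards [eventually_le_atBot (0 : ℝ)] with s hs
      have := hdiff hs
      simp only [hh0, mul_zero, sub_zero, id] at this ⊢
      linarith
  let e := hmono.orderIsoOfSurjective h hsurj
  have he : ∀ s, e s = h s := fun s => rfl
  have hk : ∀ t, HasDerivAt e.symm (G (e.symm t))⁻¹ t := fun t => by
    refine HasDerivAt.of_local_left_inverse e.symm.continuous.continuousAt (hder (e.symm t))
      (hc.trans_le (hGmin _)).ne' (Eventually.of_forall fun y => e.apply_symm_apply y)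
  have hk0 : e.symm 0 = 0 := by rw [OrderIso.symm_apply_eq, he, hh0]
  have hkτ : e.symm (h τ) = τ := e.symm_apply_apply τ
  refine ⟨e.symm, h τ, by rw [← hh0]; exact hmono hτ, fun t ht => ?_, hk0, hkτ, fun t ht => ?_⟩
  · have hmaps : Set.MapsTo e.symm (Set.Icc 0 (h τ)) (Set.Icc 0 τ) := fun q hq => by
      rw [Set.mem_Icc, ← hk0, ← hkτ]
      simpa using hq
    have h1 := (hΓ.hasDeriv (e.symm t) (hmaps ht)).scomp t (hk t).hasDerivWithinAt hmaps
    rw [hGg _ (hmaps ht), smul_smul, inv_mul_cancel₀ (hg _ (hmaps ht)).ne', one_smul] at h1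
    exact h1
  · rw [Set.mem_Ioo, ← hk0, ← hkτ]
    simpa using ht

end IsOrbit

/-! ### Half returns and the trajectories that follow them. -/

/-- The orbit of `V` through `(x, 0)` meets the `x`-axis for the next time at `(b, 0)`, on the
other side of the origin; for `x > 0` it lies in the upper, for `x < 0` in the lower half plane,
and it remains within a distance `C * |x|` of the origin. -/
def HalfReturn (V : ℝ × ℝ → ℝ × ℝ) (C x b : ℝ) : Prop :=
  x * b < 0 ∧ ∃ (Γ : ℝ → ℝ × ℝ) (g : ℝ → ℝ) (τ : ℝ), 0 < τ ∧ IsOrbit V Γ g τ ∧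
    (∀ s ∈ Set.Icc 0 τ, 0 < g s) ∧ Γ 0 = (x, 0) ∧ Γ τ = (b, 0) ∧
    (∀ s ∈ Set.Ioo 0 τ, 0 < x * (Γ s).2) ∧ ∀ s ∈ Set.Icc 0 τ, ‖Γ s‖ ≤ C * |x|

namespace HalfReturn

variable {V : ℝ × ℝ → ℝ × ℝ} {C x b r : ℝ} {K : NNReal}

theorem exists_trajectory (h : HalfReturn V C x b) : ∃ (γ : ℝ → ℝ × ℝ) (T : ℝ), 0 < T ∧
    IsTrajectory V γ T ∧ γ 0 = (x, 0) ∧ γ T = (b, 0) ∧ ∀ t ∈ Set.Ioo 0 T, 0 < x * (γ t).2 := by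
  obtain ⟨-, Γ, g, τ, hτ, hΓ, hg, hΓ0, hΓτ, hpos, -⟩ := h
  obtain ⟨k, T, hT, hγ, hk0, hkT, hk⟩ := hΓ.exists_trajectory hτ hg
  exact ⟨fun t => Γ (k t), T, hT, hγ, by simp only [hk0, hΓ0], by simp only [hkT, hΓτ],
    fun t ht => hpos _ (hk t ht)⟩

/-- A trajectory starting at `(x, 0)` either follows the half return or stops inside it. -/
theorem follow (h : HalfReturn V C x b) (hV : LipschitzOnWith K V (Metric.ball 0 r))
    (hr : C * |x| < r) {γ : ℝ → ℝ × ℝ} {T : ℝ} (hT : 0 < T) (hγ : IsTrajectory V γ T)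
    (h0 : γ 0 = (x, 0)) : 0 < x * (γ T).2 ∨ ∃ t ∈ Set.Ioc 0 T, γ t = (b, 0) := by
  obtain ⟨-, Γ, g, τ, hτ, hΓ, -, hΓ0, hΓτ, hpos, hbd⟩ := h
  rw [← hΓτ]
  exact hΓ.follow hτ Metric.isOpen_ball hV
    (fun s hs => mem_ball_zero_iff.2 ((hbd s hs).trans_lt hr)) hpos hT hγ (h0.trans hΓ0.symm)

theorem eq_of_trajectory (h : HalfReturn V C x b) (hV : LipschitzOnWith K V (Metric.ball 0 r))
    (hr : C * |x| < r) {γ : ℝ → ℝ × ℝ} {T c : ℝ} (hT : 0 < T) (hγ : IsTrajectory V γ T)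
    (h0 : γ 0 = (x, 0)) (hγT : γ T = (c, 0)) (hne : ∀ t ∈ Set.Ioo 0 T, (γ t).2 ≠ 0) :
    c = b := by
  obtain ⟨-, Γ, g, τ, hτ, hΓ, -, hΓ0, hΓτ, hpos, hbd⟩ := h
  have := hΓ.eq_of_trajectory hτ Metric.isOpen_ball hV
    (fun s hs => mem_ball_zero_iff.2 ((hbd s hs).trans_lt hr)) hpos (by rw [hΓτ]) hT hγ
    (h0.trans hΓ0.symm) (by rw [hγT]) hne
  rw [hγT, hΓτ] at this
  exact congrArg Prod.fst this

theorem eq_of_upperTransition (h : HalfReturn V C x b)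
    (hV : LipschitzOnWith K V (Metric.ball 0 r)) (hr : C * |x| < r) {c : ℝ}
    (hc : UpperTransition V x c) : c = b := by
  obtain ⟨γ, T, hT, hγ, h0, hγT, hpos⟩ := hc
  exact h.eq_of_trajectory hV hr hT hγ h0 hγT fun t ht => (hpos t ht).ne'

theorem eq_of_lowerTransition (h : HalfReturn V C x b)
    (hV : LipschitzOnWith K V (Metric.ball 0 r)) (hr : C * |x| < r) {c : ℝ}
    (hc : LowerTransition V x c) : c = b := by
  obtain ⟨γ, T, hT, hγ, h0, hγT, hpos⟩ := hc
  exact h.eq_of_trajectory hV hr hT hγ h0 hγT fun t ht => (hpos t ht).ne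

/-- The trajectory cannot stop inside the first half turn, nor at `(b, 0)` since `b < 0`. Restarted
there, it follows the second half turn to `(d, 0)` with `d > 0`; arriving before the final time
would contradict the first return. -/
theorem eq_of_firstReturn (hx : 0 < x) (h : HalfReturn V C x b) {d : ℝ}
    (h' : HalfReturn V C b d)
    (hV : LipschitzOnWith K V (Metric.ball 0 r)) (hr : C * |x| < r) (hr' : C * |b| < r) {c : ℝ}
    (hc : FirstReturn V x c) : c = d := by
  obtain ⟨-, hc0, γ, T, hT, hγ, h0, hγT, hret⟩ := hc
  have hb : b < 0 := by
    have := h.1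
    by_contra hb
    exact absurd (mul_nonneg hx.le (not_lt.1 hb)) (not_le.2 this)
  have hd : 0 < d := by
    by_contra hd
    exact absurd (mul_nonneg_of_nonpos_of_nonpos hb.le (not_lt.1 hd)) (not_le.2 h'.1)
  rcases h.follow hV hr hT hγ h0 with h1 | ⟨t, ht, h1⟩
  · simp [hγT] at h1
  have htT : t < T := by
    refine lt_of_le_of_ne ht.2 ?_
    rintro rfl
    rw [hγT, Prod.mk.injEq] at h1
    linarith [h1.1]
  have hshift : IsTrajectory V (fun s => γ (t + s)) (T - t) := by
    intro s hs
    have hmem : t + s ∈ Set.Icc 0 T := ⟨by linarith [ht.1, hs.1], by linarith [hs.2]⟩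
    have h2 : HasDerivWithinAt (fun s : ℝ => t + s) 1 (Set.Icc 0 (T - t)) s :=
      (hasDerivWithinAt_id s _).const_add t
    have := (hγ (t + s) hmem).scomp s h2
      (fun q hq => ⟨by linarith [ht.1, hq.1], by linarith [hq.2]⟩)
    rwa [one_smul] at this
  rcases h'.follow hV hr' (sub_pos.2 htT) hshift (by simpa using h1) with h2 | ⟨s, hs, h2⟩
  · simp [hγT] at h2
  · rcases hs.2.lt_or_eq with hlt | rfl
    · refine absurd ?_ (hret (t + s) ⟨by linarith [ht.1, hs.1], by linarith⟩)
      simp [h2, hd]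
    · simp only [add_sub_cancel, hγT, Prod.mk.injEq, and_true] at h2
      exact h2

end HalfReturn

/-! ### Taylor expansion of a vector field in polar coordinates. -/

/-- The function `c₁(θ) M(r cos θ, r sin θ) + c₂(θ) N(r cos θ, r sin θ)`, for `V = (M, N)`. -/
noncomputable def polarComp (c₁ c₂ : ℝ → ℝ) (V : ℝ × ℝ → ℝ × ℝ) (θ r : ℝ) : ℝ :=
  c₁ θ * (V (r • (Real.cos θ, Real.sin θ))).1 + c₂ θ * (V (r • (Real.cos θ, Real.sin θ))).2

/-- The radial component of `V` in polar coordinates. -/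
noncomputable abbrev radialComp := polarComp Real.cos Real.sin

/-- The angular component of `V` in polar coordinates. -/
noncomputable abbrev angularComp := polarComp (fun θ => -Real.sin θ) Real.cos

section Taylor

variable {c₁ c₂ : ℝ → ℝ} {V : ℝ × ℝ → ℝ × ℝ}

theorem norm_smul_cos_sin_le (r θ : ℝ) : ‖r • ((Real.cos θ, Real.sin θ) : ℝ × ℝ)‖ ≤ |r| := by
  rw [norm_smul, Real.norm_eq_abs]
  refine mul_le_of_le_one_right (abs_nonneg r) ?_
  rw [Prod.norm_mk]
  exact max_le (Real.abs_cos_le_one θ) (Real.abs_sin_le_one θ)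

theorem polarComp_homogeneous (p : FormalMultilinearSeries ℝ (ℝ × ℝ) (ℝ × ℝ)) (i : ℕ) (θ r : ℝ) :
    polarComp c₁ c₂ (fun z => p i fun _ => z) θ r =
      r ^ i * polarComp c₁ c₂ (fun z => p i fun _ => z) θ 1 := by
  have h : (p i fun _ => r • ((Real.cos θ, Real.sin θ) : ℝ × ℝ)) =
      r ^ i • p i fun _ => ((Real.cos θ, Real.sin θ) : ℝ × ℝ) := by
    simpa using (p i).map_smul_univ (fun _ => r) (fun _ => ((Real.cos θ, Real.sin θ) : ℝ × ℝ))
  simp only [polarComp, h, one_smul, Prod.smul_fst, Prod.smul_snd, smul_eq_mul]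
  ring

theorem continuous_polarComp_one (h₁ : Continuous c₁) (h₂ : Continuous c₂) (hV : Continuous V) :
    Continuous fun θ => polarComp c₁ c₂ V θ 1 := by
  have hV' : Continuous fun θ : ℝ => V ((1 : ℝ) • (Real.cos θ, Real.sin θ)) := by fun_prop
  exact (h₁.mul hV'.fst).add (h₂.mul hV'.snd)

/-- The Taylor remainder depends only on the norm of the point, which is at most `|r|` for every
angle; hence the uniformity in `θ`. -/
theorem exists_abs_polarComp_sub_le {p : FormalMultilinearSeries ℝ (ℝ × ℝ) (ℝ × ℝ)}
    (hp : HasFPowerSeriesAt V p 0) (h₁ : ∀ θ, |c₁ θ| ≤ 1) (h₂ : ∀ θ, |c₂ θ| ≤ 1) (n : ℕ) :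
    ∃ C, ∀ᶠ r in 𝓝 (0 : ℝ), ∀ θ, |polarComp c₁ c₂ V θ r -
      ∑ i ∈ Finset.range n, r ^ i * polarComp c₁ c₂ (fun z => p i fun _ => z) θ 1|
        ≤ C * |r| ^ n := by
  obtain ⟨C, hC⟩ := (hp.isBigO_sub_partialSum_pow n).bound
  obtain ⟨δ, hδ, hball⟩ := Metric.eventually_nhds_iff_ball.1 hC
  refine ⟨2 * |C|, ?_⟩
  filter_upwards [Metric.ball_mem_nhds (0 : ℝ) hδ] with r hr θ
  rw [mem_ball_zero_iff, Real.norm_eq_abs] at hr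
  have hz := norm_smul_cos_sin_le r θ
  have hb := hball _ (mem_ball_zero_iff.2 (hz.trans_lt hr))
  rw [zero_add] at hb
  have hsum : polarComp c₁ c₂ V θ r -
      ∑ i ∈ Finset.range n, r ^ i * polarComp c₁ c₂ (fun z => p i fun _ => z) θ 1 =
      polarComp c₁ c₂ (fun z => V z - p.partialSum n z) θ r := by
    simp_rw [← polarComp_homogeneous]
    simp only [polarComp, FormalMultilinearSeries.partialSum, Prod.fst_sub, Prod.snd_sub,
      Prod.fst_sum, Prod.snd_sum, Finset.sum_add_distrib, Finset.mul_sum, mul_sub]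
    ring
  rw [hsum]
  set w := V (r • (Real.cos θ, Real.sin θ)) - p.partialSum n (r • (Real.cos θ, Real.sin θ))
  have hw : ‖w‖ ≤ |C| * |r| ^ n := by
    refine hb.trans ?_
    rw [norm_pow, norm_norm]
    exact mul_le_mul (le_abs_self C) (pow_le_pow_left₀ (norm_nonneg _) hz n) (by positivity)
      (abs_nonneg C)
  have e1 : |c₁ θ * w.1| ≤ 1 * ‖w‖ := by
    rw [abs_mul]
    exact mul_le_mul (h₁ θ) (norm_fst_le w) (abs_nonneg _) zero_le_one
  have e2 : |c₂ θ * w.2| ≤ 1 * ‖w‖ := by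
    rw [abs_mul]
    exact mul_le_mul (h₂ θ) (norm_snd_le w) (abs_nonneg _) zero_le_one
  calc |c₁ θ * w.1 + c₂ θ * w.2| ≤ 1 * ‖w‖ + 1 * ‖w‖ := (abs_add_le _ _).trans (add_le_add e1 e2)
    _ ≤ 2 * |C| * |r| ^ n := by linarith

/-- The nonlinear part of `polarComp`, divided by `r²`. -/
noncomputable def polarRem (c₁ c₂ : ℝ → ℝ) (V : ℝ × ℝ → ℝ × ℝ) (θ r : ℝ) : ℝ :=
  (polarComp c₁ c₂ V θ r - r * polarComp c₁ c₂ (fderiv ℝ V 0) θ 1) / r ^ 2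

theorem polarComp_eq (c₁ c₂ : ℝ → ℝ) (V : ℝ × ℝ → ℝ × ℝ) (θ : ℝ) {r : ℝ} (hr : r ≠ 0) :
    polarComp c₁ c₂ V θ r =
      r * (polarComp c₁ c₂ (fderiv ℝ V 0) θ 1 + r * polarRem c₁ c₂ V θ r) := by
  rw [polarRem]
  field_simp
  ring

theorem sum_range_add_two_polarComp {p : FormalMultilinearSeries ℝ (ℝ × ℝ) (ℝ × ℝ)}
    (hp : HasFPowerSeriesAt V p 0) (h0 : V 0 = 0) (n : ℕ) (θ r : ℝ) :
    ∑ i ∈ Finset.range (n + 2), r ^ i * polarComp c₁ c₂ (fun z => p i fun _ => z) θ 1 =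
      r * polarComp c₁ c₂ (fderiv ℝ V 0) θ 1 + r ^ 2 *
        ∑ i ∈ Finset.range n, r ^ i * polarComp c₁ c₂ (fun z => p (i + 2) fun _ => z) θ 1 := by
  have e0 : (fun z : ℝ × ℝ => p 0 fun _ => z) = fun _ => 0 := by
    funext z
    rw [hp.coeff_zero, h0]
  have e1 : (fun z : ℝ × ℝ => p 1 fun _ => z) = fderiv ℝ V 0 := by
    funext z
    rw [hp.hasFDerivAt.fderiv]
    simp only [continuousMultilinearCurryFin1_apply]
    congr 1
  rw [Finset.sum_range_succ', Finset.sum_range_succ', e0, e1, Finset.mul_sum]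
  simp only [polarComp, pow_zero, Prod.fst_zero, Prod.snd_zero, mul_zero, add_zero, zero_add,
    pow_one]
  rw [add_comm]
  congr 1
  exact Finset.sum_congr rfl fun i _ => by ring

theorem exists_abs_polarRem_le (hV : AnalyticAt ℝ V 0) (h0 : V 0 = 0) (h₁ : ∀ θ, |c₁ θ| ≤ 1)
    (h₂ : ∀ θ, |c₂ θ| ≤ 1) : ∃ C, ∀ᶠ r in 𝓝 (0 : ℝ), ∀ θ, |polarRem c₁ c₂ V θ r| ≤ C := by
  obtain ⟨p, hp⟩ := hV
  obtain ⟨C, hC⟩ := exists_abs_polarComp_sub_le (c₁ := c₁) (c₂ := c₂) hp h₁ h₂ 2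
  refine ⟨|C|, ?_⟩
  filter_upwards [hC] with r hr θ
  have h := hr θ
  rw [sum_range_add_two_polarComp hp h0 0] at h
  simp only [Finset.range_zero, Finset.sum_empty, mul_zero, add_zero] at h
  rw [polarRem, abs_div, abs_pow]
  refine div_le_of_le_mul₀ (by positivity) (abs_nonneg C) (h.trans ?_)
  exact mul_le_mul_of_nonneg_right (le_abs_self C) (by positivity)

/-- The expansion of r = ε s is substituted into the Taylor polynomial of the field. Division by r²
costs two orders, which is why the field is expanded to order `m + 2`; the bound on `s` turns powers
of r into powers of ε. -/
theorem HasUnifExpansion.polarRem {S : Set ℝ} (hS : IsCompact S) (hV : AnalyticAt ℝ V 0)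
    (h0 : V 0 = 0) (hc₁ : Continuous c₁) (hc₂ : Continuous c₂) (h₁ : ∀ θ, |c₁ θ| ≤ 1)
    (h₂ : ∀ θ, |c₂ θ| ≤ 1) {m : ℕ} {s : ℝ → ℝ → ℝ} (hs : HasUnifExpansion S m s) {A : ℝ}
    (hsA : ∀ᶠ ε in 𝓝[≠] (0 : ℝ), ∀ θ ∈ S, 0 < s ε θ ∧ s ε θ ≤ A) :
    HasUnifExpansion S m fun ε θ => polarRem c₁ c₂ V θ (ε * s ε θ) := by
  obtain ⟨p, hp⟩ := hV
  obtain ⟨C, hC⟩ := exists_abs_polarComp_sub_le (c₁ := c₁) (c₂ := c₂) hp h₁ h₂ (m + 2)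
  have hr := hs.eps_mul.of_succ hS
  have hsum := HasUnifExpansion.sum hS (m := m) (Finset.range m)
    (F := fun i ε θ => (ε * s ε θ) ^ i * polarComp c₁ c₂ (fun z => p (i + 2) fun _ => z) θ 1)
    (fun i _ => (hr.pow hS i).mul hS (of_continuousOn hS (continuous_polarComp_one hc₁ hc₂
      (by
        have : Continuous fun z : ℝ × ℝ => fun _ : Fin (i + 2) => z :=
          continuous_pi fun _ => continuous_id
        exact (p (i + 2)).cont.comp this)).continuousOn m))
  have hsmall : ∀ᶠ ε in 𝓝[≠] (0 : ℝ), ∀ θ ∈ S, ∀ θ', |polarComp c₁ c₂ V θ' (ε * s ε θ) -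
      ∑ i ∈ Finset.range (m + 2), (ε * s ε θ) ^ i *
        polarComp c₁ c₂ (fun z => p i fun _ => z) θ' 1| ≤ C * |ε * s ε θ| ^ (m + 2) := by
    obtain ⟨δ, hδ, hball⟩ := Metric.eventually_nhds_iff_ball.1 hC
    have hlim : Tendsto (fun ε : ℝ => |ε| * A) (𝓝[≠] 0) (𝓝 0) :=
      ((continuous_abs.mul continuous_const).tendsto' 0 0 (by simp)).mono_left
        nhdsWithin_le_nhds
    filter_upwards [hsA, hlim.eventually_lt_const hδ] with ε h1 h2 θ hθ θ'
    refine hball _ (mem_ball_zero_iff.2 ?_) θ'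
    rw [Real.norm_eq_abs, abs_mul, abs_of_pos (h1 θ hθ).1]
    exact (mul_le_mul_of_nonneg_left (h1 θ hθ).2 (abs_nonneg ε)).trans_lt h2
  have hrem := of_bound (S := S) (m := m) (C := |C| * A ^ m)
    (f := fun ε θ => _root_.polarRem c₁ c₂ V θ (ε * s ε θ) - ∑ i ∈ Finset.range m,
      (ε * s ε θ) ^ i * polarComp c₁ c₂ (fun z => p (i + 2) fun _ => z) θ 1) (by
    filter_upwards [hsmall, hsA, self_mem_nhdsWithin] with ε h1 h2 (h3 : ε ≠ 0) θ hθ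
    have h4 := h1 θ hθ θ
    rw [sum_range_add_two_polarComp hp h0] at h4
    have hs0 := (h2 θ hθ).1
    have hr0 : ε * s ε θ ≠ 0 := mul_ne_zero h3 hs0.ne'
    set r := ε * s ε θ with hrdef
    have e : _root_.polarRem c₁ c₂ V θ r - ∑ i ∈ Finset.range m,
        r ^ i * polarComp c₁ c₂ (fun z => p (i + 2) fun _ => z) θ 1 =
        (polarComp c₁ c₂ V θ r - (r * polarComp c₁ c₂ (fderiv ℝ V 0) θ 1 + r ^ 2 *
          ∑ i ∈ Finset.range m, r ^ i * polarComp c₁ c₂ (fun z => p (i + 2) fun _ => z) θ 1))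
          / r ^ 2 := by
      rw [_root_.polarRem]
      field_simp
      ring
    rw [e, abs_div, div_le_iff₀ (abs_pos.2 (pow_ne_zero 2 hr0))]
    refine h4.trans ?_
    rw [abs_pow, pow_add, ← mul_assoc]
    refine mul_le_mul_of_nonneg_right ?_ (by positivity)
    rw [mul_assoc]
    refine mul_le_mul (le_abs_self C) ?_ (by positivity) (abs_nonneg C)
    rw [← mul_pow, hrdef, abs_mul, abs_of_pos hs0, mul_comm A]
    exact pow_le_pow_left₀ (by positivity)
      (mul_le_mul_of_nonneg_left (h2 θ hθ).2 (abs_nonneg ε)) m)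
  exact (hrem.add hsum).congr (Eventually.of_forall fun ε θ _ => by ring)

end Taylor

/-! ### The rescaled radial equation and the half return map. -/

section HalfReturn

variable {V : ℝ × ℝ → ℝ × ℝ}

/-- The solution `exp ∫ a/b` of the radial equation of the linear part of `V`. -/
noncomputable def radialFactor (V : ℝ × ℝ → ℝ × ℝ) (θ : ℝ) : ℝ :=
  Real.exp (∫ s in (0 : ℝ)..θ,
    radialComp (fderiv ℝ V 0) s 1 / angularComp (fderiv ℝ V 0) s 1)

theorem radialFactor_pos (V : ℝ × ℝ → ℝ × ℝ) (θ : ℝ) : 0 < radialFactor V θ := Real.exp_pos _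

theorem radialFactor_zero (V : ℝ × ℝ → ℝ × ℝ) : radialFactor V 0 = 1 := by simp [radialFactor]

/-- With `r = ε ρ u`, where `ρ` is the radial factor, the equation for the orbits of `V` in polar
coordinates is `du/dθ = angularRhs V ε θ u`. -/
noncomputable def angularRhs (V : ℝ × ℝ → ℝ × ℝ) (ε θ u : ℝ) : ℝ :=
  u * (radialComp V θ (ε * (radialFactor V θ * u)) / angularComp V θ (ε * (radialFactor V θ * u))
    - radialComp (fderiv ℝ V 0) θ 1 / angularComp (fderiv ℝ V 0) θ 1)

theorem continuous_radialComp_fderiv (V : ℝ × ℝ → ℝ × ℝ) :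
    Continuous fun θ => radialComp (fderiv ℝ V 0) θ 1 :=
  continuous_polarComp_one Real.continuous_cos Real.continuous_sin (fderiv ℝ V 0).continuous

theorem continuous_angularComp_fderiv (V : ℝ × ℝ → ℝ × ℝ) :
    Continuous fun θ => angularComp (fderiv ℝ V 0) θ 1 :=
  continuous_polarComp_one Real.continuous_sin.neg Real.continuous_cos (fderiv ℝ V 0).continuous

theorem contDiff_polarComp_fderiv {c₁ c₂ : ℝ → ℝ} (h₁ : ContDiff ℝ 1 c₁) (h₂ : ContDiff ℝ 1 c₂)
    (V : ℝ × ℝ → ℝ × ℝ) : ContDiff ℝ 1 fun θ => polarComp c₁ c₂ (fderiv ℝ V 0) θ 1 := by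
  have h : ContDiff ℝ 1 fun θ : ℝ => fderiv ℝ V 0 ((1 : ℝ) • (Real.cos θ, Real.sin θ)) := by
    simp only [one_smul]
    exact (fderiv ℝ V 0).contDiff.comp (Real.contDiff_cos.prodMk Real.contDiff_sin)
  exact (h₁.mul h.fst).add (h₂.mul h.snd)

variable (hb : ∀ θ, 0 < angularComp (fderiv ℝ V 0) θ 1)
include hb

theorem hasDerivAt_radialFactor (θ : ℝ) :
    HasDerivAt (radialFactor V) (radialFactor V θ *
      (radialComp (fderiv ℝ V 0) θ 1 / angularComp (fderiv ℝ V 0) θ 1)) θ := by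
  have hc : Continuous fun s => radialComp (fderiv ℝ V 0) s 1 / angularComp (fderiv ℝ V 0) s 1 :=
    (continuous_radialComp_fderiv V).div (continuous_angularComp_fderiv V) fun θ => (hb θ).ne'
  exact (hc.integral_hasStrictDerivAt 0 θ).hasDerivAt.exp

theorem contDiff_radialFactor : ContDiff ℝ 1 (radialFactor V) := by
  have hd := hasDerivAt_radialFactor hb
  refine contDiff_one_iff_deriv.2 ⟨fun θ => (hd θ).differentiableAt, ?_⟩
  rw [show deriv (radialFactor V) = _ from funext fun θ => (hd θ).deriv]
  have hρ : Continuous (radialFactor V) :=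
    continuous_iff_continuousAt.2 fun θ => (hd θ).continuousAt
  exact hρ.mul ((continuous_radialComp_fderiv V).div (continuous_angularComp_fderiv V)
    fun θ => (hb θ).ne')

/-- The linear parts cancel in the difference of the two quotients. The explicit factor ε that
remains gives both the existence of solutions over a half turn and the gain of one order per
integration. -/
theorem angularRhs_eq {ε θ u : ℝ} (hε : ε ≠ 0) (hu : u ≠ 0)
    (hr : angularComp (fderiv ℝ V 0) θ 1 + ε * (radialFactor V θ * u) *
      polarRem (fun θ => -Real.sin θ) Real.cos V θ (ε * (radialFactor V θ * u)) ≠ 0) :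
    angularRhs V ε θ u = ε * (u * (radialFactor V θ * u) *
      (polarRem Real.cos Real.sin V θ (ε * (radialFactor V θ * u)) *
          angularComp (fderiv ℝ V 0) θ 1 -
        radialComp (fderiv ℝ V 0) θ 1 *
          polarRem (fun θ => -Real.sin θ) Real.cos V θ (ε * (radialFactor V θ * u))) *
      (angularComp (fderiv ℝ V 0) θ 1)⁻¹ *
      (angularComp (fderiv ℝ V 0) θ 1 + ε * (radialFactor V θ * u) *
        polarRem (fun θ => -Real.sin θ) Real.cos V θ (ε * (radialFactor V θ * u)))⁻¹) := by
  have hb' := (hb θ).ne'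
  have hs : radialFactor V θ * u ≠ 0 := mul_ne_zero (radialFactor_pos V θ).ne' hu
  have hr0 : ε * (radialFactor V θ * u) ≠ 0 := mul_ne_zero hε hs
  rw [angularRhs, radialComp, angularComp, polarComp_eq Real.cos Real.sin V θ hr0,
    polarComp_eq (fun θ => -Real.sin θ) Real.cos V θ hr0, mul_div_mul_left _ _ hr0]
  rw [angularComp] at hr hb'
  generalize polarRem (fun θ => -Real.sin θ) Real.cos V θ (ε * (radialFactor V θ * u)) = β at *
  generalize polarRem Real.cos Real.sin V θ (ε * (radialFactor V θ * u)) = α at *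
  generalize polarComp (fun θ => -Real.sin θ) Real.cos (fderiv ℝ V 0) θ 1 = b at *
  generalize polarComp Real.cos Real.sin (fderiv ℝ V 0) θ 1 = a at *
  generalize radialFactor V θ * u = s at *
  field_simp
  ring

variable (hV : AnalyticAt ℝ V 0) (h0 : V 0 = 0)
include hV h0

/-- All bounds come from compactness of the angular interval and positivity of the linear angular
component there. For small ε the nonlinear correction uses up at most half of its minimum. -/
theorem exists_angularRhs_bounds : ∃ A c Q : ℝ, 0 < A ∧ 0 < c ∧ 0 ≤ Q ∧
    (∀ θ ∈ Set.Icc 0 Real.pi, radialFactor V θ ≤ A) ∧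
    ∀ᶠ ε in 𝓝[≠] (0 : ℝ), ∀ θ ∈ Set.Icc 0 Real.pi, ∀ u ∈ Set.Icc (1 / 2 : ℝ) (3 / 2),
      c ≤ angularComp (fderiv ℝ V 0) θ 1 + ε * (radialFactor V θ * u) *
        polarRem (fun θ => -Real.sin θ) Real.cos V θ (ε * (radialFactor V θ * u)) ∧
      |angularRhs V ε θ u| ≤ Q * |ε| ∧
      AnalyticAt ℝ V ((ε * (radialFactor V θ * u)) • (Real.cos θ, Real.sin θ)) := by
  have hne : (Set.Icc 0 Real.pi).Nonempty := ⟨0, le_rfl, Real.pi_pos.le⟩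
  obtain ⟨A, hA⟩ := isCompact_Icc.exists_bound_of_continuousOn
    (contDiff_radialFactor hb).continuous.continuousOn (s := Set.Icc 0 Real.pi)
  obtain ⟨a', ha'⟩ := isCompact_Icc.exists_bound_of_continuousOn
    (continuous_radialComp_fderiv V).continuousOn (s := Set.Icc 0 Real.pi)
  obtain ⟨b', hb'⟩ := isCompact_Icc.exists_bound_of_continuousOn
    (continuous_angularComp_fderiv V).continuousOn (s := Set.Icc 0 Real.pi)
  obtain ⟨θ₀, -, hθ₀⟩ := isCompact_Icc.exists_isMinOn hne
    (continuous_angularComp_fderiv V).continuousOn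
  set b₀ := angularComp (fderiv ℝ V 0) θ₀ 1 with hb₀
  have hb₀pos : 0 < b₀ := hb θ₀
  have hcos := Real.abs_cos_le_one
  have hsin := Real.abs_sin_le_one
  have hsin' : ∀ θ : ℝ, |-Real.sin θ| ≤ 1 := fun θ => by rw [abs_neg]; exact hsin θ
  obtain ⟨C₁, hC₁⟩ := exists_abs_polarRem_le (c₁ := Real.cos) (c₂ := Real.sin) hV h0 hcos hsin
  obtain ⟨C₂, hC₂⟩ := exists_abs_polarRem_le (c₁ := fun θ => -Real.sin θ) (c₂ := Real.cos)
    hV h0 hsin' hcos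
  have hApos : 0 < A := (radialFactor_pos V 0).trans_le
    ((le_abs_self _).trans (hA 0 ⟨le_rfl, Real.pi_pos.le⟩))
  have hAn : ∀ᶠ r in 𝓝 (0 : ℝ), ∀ θ : ℝ, AnalyticAt ℝ V (r • (Real.cos θ, Real.sin θ)) := by
    obtain ⟨δ, hδ, hball⟩ := Metric.eventually_nhds_iff_ball.1 hV.eventually_analyticAt
    filter_upwards [Metric.ball_mem_nhds (0 : ℝ) hδ] with r hr θ
    rw [mem_ball_zero_iff, Real.norm_eq_abs] at hr
    exact hball _ (mem_ball_zero_iff.2 ((norm_smul_cos_sin_le r θ).trans_lt hr))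
  obtain ⟨δ, hδ, hball⟩ := Metric.eventually_nhds_iff_ball.1 ((hC₁.and hC₂).and hAn)
  have hlim : Tendsto (fun ε : ℝ => |ε| * (A * (3 / 2))) (𝓝[≠] 0) (𝓝 0) :=
    ((continuous_abs.mul continuous_const).tendsto' 0 0 (by simp)).mono_left nhdsWithin_le_nhds
  have hlim' : Tendsto (fun ε : ℝ => |ε| * (A * (3 / 2)) * |C₂|) (𝓝[≠] 0) (𝓝 0) := by
    simpa using hlim.mul_const |C₂|
  refine ⟨A, b₀ / 2, 3 / 2 * (A * (3 / 2)) * (|C₁| * b' + a' * |C₂|) * b₀⁻¹ * (b₀ / 2)⁻¹, hApos,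
    half_pos hb₀pos, ?_, fun θ hθ => (le_abs_self _).trans (hA θ hθ), ?_⟩
  · have h1 := (norm_nonneg _).trans (ha' 0 ⟨le_rfl, Real.pi_pos.le⟩)
    have h2 := (norm_nonneg _).trans (hb' 0 ⟨le_rfl, Real.pi_pos.le⟩)
    positivity
  filter_upwards [hlim.eventually_lt_const hδ, hlim'.eventually_lt_const (half_pos hb₀pos),
    self_mem_nhdsWithin] with ε h1 h2 (hε : ε ≠ 0) θ hθ u hu
  have hu0 : 0 < u := lt_of_lt_of_le (by norm_num) hu.1
  have hs0 : 0 < radialFactor V θ * u := mul_pos (radialFactor_pos V θ) hu0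
  have hsA : radialFactor V θ * u ≤ A * (3 / 2) :=
    mul_le_mul ((le_abs_self _).trans (hA θ hθ)) hu.2 hu0.le hApos.le
  have hrA : |ε * (radialFactor V θ * u)| ≤ |ε| * (A * (3 / 2)) := by
    rw [abs_mul, abs_of_pos hs0]
    exact mul_le_mul_of_nonneg_left hsA (abs_nonneg ε)
  obtain ⟨⟨hr1, hr2⟩, hr3⟩ := hball (ε * (radialFactor V θ * u))
    (mem_ball_zero_iff.2 (hrA.trans_lt h1))
  have hβ : |polarRem (fun θ => -Real.sin θ) Real.cos V θ (ε * (radialFactor V θ * u))| ≤ |C₂| :=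
    (hr2 θ).trans (le_abs_self _)
  have hα : |polarRem Real.cos Real.sin V θ (ε * (radialFactor V θ * u))| ≤ |C₁| :=
    (hr1 θ).trans (le_abs_self _)
  have hbθ : b₀ ≤ angularComp (fderiv ℝ V 0) θ 1 := hθ₀ hθ
  have hc : b₀ / 2 ≤ angularComp (fderiv ℝ V 0) θ 1 + ε * (radialFactor V θ * u) *
      polarRem (fun θ => -Real.sin θ) Real.cos V θ (ε * (radialFactor V θ * u)) := by
    have : |ε * (radialFactor V θ * u) *
        polarRem (fun θ => -Real.sin θ) Real.cos V θ (ε * (radialFactor V θ * u))|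
        ≤ |ε| * (A * (3 / 2)) * |C₂| := by
      rw [abs_mul]
      exact mul_le_mul hrA hβ (abs_nonneg _) (by positivity)
    have := (abs_le.1 this).1
    linarith
  refine ⟨hc, ?_, hr3 θ⟩
  rw [angularRhs_eq hb hε hu0.ne' ((half_pos hb₀pos).trans_le hc).ne', abs_mul, mul_comm _ |ε|]
  refine mul_le_mul_of_nonneg_left ?_ (abs_nonneg ε)
  have h3 : |u| ≤ 3 / 2 := by rw [abs_of_pos hu0]; exact hu.2
  have h4 : |radialFactor V θ * u| ≤ A * (3 / 2) := by rw [abs_of_pos hs0]; exact hsA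
  have h5 := ha' θ hθ
  have h6 := hb' θ hθ
  rw [Real.norm_eq_abs] at h5 h6
  have h7 : |(angularComp (fderiv ℝ V 0) θ 1)⁻¹| ≤ b₀⁻¹ := by
    rw [abs_of_pos (inv_pos.2 (hb θ))]
    exact inv_anti₀ hb₀pos hbθ
  have h8 : |(angularComp (fderiv ℝ V 0) θ 1 + ε * (radialFactor V θ * u) *
      polarRem (fun θ => -Real.sin θ) Real.cos V θ (ε * (radialFactor V θ * u)))⁻¹|
      ≤ (b₀ / 2)⁻¹ := by
    rw [abs_of_pos (inv_pos.2 ((half_pos hb₀pos).trans_le hc))]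
    exact inv_anti₀ (half_pos hb₀pos) hc
  have ha0 : 0 ≤ a' := (abs_nonneg _).trans h5
  have hb0 : 0 ≤ b' := (abs_nonneg _).trans h6
  simp only [abs_mul _ _] at h4 ⊢
  gcongr
  refine (abs_sub _ _).trans ?_
  rw [abs_mul, abs_mul]
  gcongr

theorem contDiffOn_angularRhs : ∀ᶠ ε in 𝓝[≠] (0 : ℝ),
    ContDiffOn ℝ 1 (fun q : ℝ × ℝ => angularRhs V ε q.1 q.2)
      (Set.Icc 0 Real.pi ×ˢ Set.Icc (1 / 2 : ℝ) (3 / 2)) := by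
  obtain ⟨A, c, Q, hA, hc, hQ, hρA, hev⟩ := exists_angularRhs_bounds hb hV h0
  filter_upwards [hev, self_mem_nhdsWithin] with ε h (hε : ε ≠ 0)
  rintro ⟨θ, u⟩ ⟨hθ, hu⟩
  obtain ⟨h1, -, h2⟩ := h θ hθ u hu
  simp only at hu hθ
  have hu0 : 0 < u := lt_of_lt_of_le (by norm_num) hu.1
  have hr0 : ε * (radialFactor V θ * u) ≠ 0 :=
    mul_ne_zero hε (mul_pos (radialFactor_pos V θ) hu0).ne'
  refine ContDiffAt.contDiffWithinAt ?_
  have hfst : ContDiff ℝ 1 (Prod.fst : ℝ × ℝ → ℝ) := contDiff_fst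
  have hsnd : ContDiff ℝ 1 (Prod.snd : ℝ × ℝ → ℝ) := contDiff_snd
  have hcos : ContDiff ℝ 1 fun q : ℝ × ℝ => Real.cos q.1 := Real.contDiff_cos.comp hfst
  have hsin : ContDiff ℝ 1 fun q : ℝ × ℝ => Real.sin q.1 := Real.contDiff_sin.comp hfst
  have hr : ContDiff ℝ 1 fun q : ℝ × ℝ => ε * (radialFactor V q.1 * q.2) :=
    contDiff_const.mul (((contDiff_radialFactor hb).comp hfst).mul hsnd)
  have hVc : ContDiffAt ℝ 1 (fun q : ℝ × ℝ =>
      V ((ε * (radialFactor V q.1 * q.2)) • (Real.cos q.1, Real.sin q.1))) (θ, u) :=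
    ContDiffAt.comp (θ, u) (g := V) h2.contDiffAt (hr.smul (hcos.prodMk hsin)).contDiffAt
  have hN : ContDiffAt ℝ 1 (fun q : ℝ × ℝ =>
      radialComp V q.1 (ε * (radialFactor V q.1 * q.2))) (θ, u) :=
    (hcos.contDiffAt.mul hVc.fst).add (hsin.contDiffAt.mul hVc.snd)
  have hD : ContDiffAt ℝ 1 (fun q : ℝ × ℝ =>
      angularComp V q.1 (ε * (radialFactor V q.1 * q.2))) (θ, u) :=
    (hsin.contDiffAt.neg.mul hVc.fst).add (hcos.contDiffAt.mul hVc.snd)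
  have hD0 : angularComp V θ (ε * (radialFactor V θ * u)) ≠ 0 := by
    rw [angularComp, polarComp_eq _ _ V θ hr0]
    exact mul_ne_zero hr0 (hc.trans_le h1).ne'
  have hL : ContDiffAt ℝ 1 (fun q : ℝ × ℝ => radialComp (fderiv ℝ V 0) q.1 1 /
      angularComp (fderiv ℝ V 0) q.1 1) (θ, u) :=
    ((contDiff_polarComp_fderiv Real.contDiff_cos Real.contDiff_sin V).comp hfst).contDiffAt.div
      ((contDiff_polarComp_fderiv Real.contDiff_sin.neg Real.contDiff_cos V).comp
        hfst).contDiffAt (hb θ).ne'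
  exact hsnd.contDiffAt.mul ((hN.div hD hD0).sub hL)

/-- Picard–Lindelöf covers the whole half turn at once: the speed is at most `Q * |ε|`, so over an
angle π the solution moves by less than 1/2 from its initial value 1. -/
theorem exists_solution_angularRhs : ∃ U : ℝ → ℝ → ℝ, ∀ᶠ ε in 𝓝[≠] (0 : ℝ), U ε 0 = 1 ∧
    ∀ θ ∈ Set.Icc 0 Real.pi, U ε θ ∈ Set.Icc (1 / 2 : ℝ) (3 / 2) ∧
      HasDerivWithinAt (U ε) (angularRhs V ε θ (U ε θ)) (Set.Icc 0 Real.pi) θ := by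
  obtain ⟨A, c, Q, hA, hc, hQ, hρA, hev⟩ := exists_angularRhs_bounds hb hV h0
  have hlim : Tendsto (fun ε : ℝ => Q * |ε| * Real.pi) (𝓝[≠] 0) (𝓝 0) :=
    (((continuous_const.mul continuous_abs).mul continuous_const).tendsto' 0 0
      (by simp)).mono_left nhdsWithin_le_nhds
  suffices h : ∀ᶠ ε in 𝓝[≠] (0 : ℝ), ∃ U : ℝ → ℝ, U 0 = 1 ∧
      ∀ θ ∈ Set.Icc 0 Real.pi, U θ ∈ Set.Icc (1 / 2 : ℝ) (3 / 2) ∧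
      HasDerivWithinAt U (angularRhs V ε θ (U θ)) (Set.Icc 0 Real.pi) θ by
    exact h.choice
  filter_upwards [hev, contDiffOn_angularRhs hb hV h0,
    hlim.eventually_lt_const (show (0 : ℝ) < 1 / 2 by norm_num)] with ε h1 h2 h3
  obtain ⟨K, hK⟩ := h2.exists_lipschitzOnWith one_ne_zero
    ((convex_Icc _ _).prod (convex_Icc _ _)) (isCompact_Icc.prod isCompact_Icc)
  have hball : Metric.closedBall (1 : ℝ) ((1 / 2 : NNReal) : ℝ) = Set.Icc (1 / 2) (3 / 2) := by
    rw [Real.closedBall_eq_Icc]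
    norm_num
  have h0mem : (0 : ℝ) ∈ Set.Icc 0 Real.pi := ⟨le_rfl, Real.pi_pos.le⟩
  have hPL : IsPicardLindelof (angularRhs V ε) (⟨0, h0mem⟩ : Set.Icc 0 Real.pi) (1 : ℝ)
      (1 / 2) 0 (Real.toNNReal (Q * |ε|)) K := by
    constructor
    · intro θ hθ
      rw [hball]
      refine LipschitzOnWith.of_dist_le_mul fun x hx y hy => ?_
      refine (hK.dist_le_mul (θ, x) ⟨hθ, hx⟩ (θ, y) ⟨hθ, hy⟩).trans_eq ?_
      simp [Prod.dist_eq]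
    · intro u hu
      rw [hball] at hu
      exact h2.continuousOn.comp (f := fun θ : ℝ => (θ, u)) (by fun_prop) fun θ hθ => ⟨hθ, hu⟩
    · intro θ hθ u hu
      rw [hball] at hu
      exact (h1 θ hθ u hu).2.1.trans (Real.le_coe_toNNReal _)
    · simp only [sub_zero, sub_self, max_eq_left Real.pi_pos.le, NNReal.coe_zero,
        Real.coe_toNNReal _ (mul_nonneg hQ (abs_nonneg ε))]
      simpa using h3.le
  -- The fixed point of the Picard operator is used directly, since it also carries the information
  -- that the solution stays in the ball.
  obtain ⟨α, hα⟩ := ODE.FunSpace.exists_isFixedPt_next hPL (Metric.mem_closedBall_self le_rfl)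
  have hmem : ∀ t, α.compProj t ∈ Metric.closedBall (1 : ℝ) ((1 / 2 : NNReal) : ℝ) :=
    fun t => α.compProj_mem_closedBall hPL.mul_max_le
  refine ⟨α.compProj, ?_, fun θ hθ => ⟨hball ▸ hmem θ, ?_⟩⟩
  · have : α.compProj ((⟨0, h0mem⟩ : Set.Icc 0 Real.pi) : ℝ) = 1 := by
      rw [ODE.FunSpace.compProj_val, ← hα, ODE.FunSpace.next_apply₀]
    exact this
  · apply ODE.hasDerivWithinAt_picard_Icc h0mem hPL.continuousOn_uncurry
      α.continuous_compProj.continuousOn (fun t _ => hmem t) 1 hθ |>.congr_of_mem _ hθ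
    intro t ht
    nth_rw 1 [← hα]
    rw [ODE.FunSpace.compProj_of_mem ht, ODE.FunSpace.next_apply]

/-- Bootstrapping in U = 1 + ∫ `angularRhs`: an expansion of `U` to order m gives one of the
integrand divided by ε to the same order, hence one of `U` to order m + 1. -/
theorem hasUnifExpansion_solution {U : ℝ → ℝ → ℝ}
    (hU : ∀ᶠ ε in 𝓝[≠] (0 : ℝ), U ε 0 = 1 ∧
      ∀ θ ∈ Set.Icc 0 Real.pi, U ε θ ∈ Set.Icc (1 / 2 : ℝ) (3 / 2) ∧
        HasDerivWithinAt (U ε) (angularRhs V ε θ (U ε θ)) (Set.Icc 0 Real.pi) θ) (m : ℕ) :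
    HasUnifExpansion (Set.Icc 0 Real.pi) m U := by
  have hS : IsCompact (Set.Icc 0 Real.pi) := isCompact_Icc
  obtain ⟨A, c, Q, hA, hc, hQ, hρA, hev⟩ := exists_angularRhs_bounds hb hV h0
  induction m with
  | zero =>
    refine ⟨3 / 2, ?_⟩
    filter_upwards [hU] with ε h θ hθ
    have := (h.2 θ hθ).1
    rw [abs_of_nonneg (le_trans (by norm_num) this.1)]
    exact this.2
  | succ m ih =>
    have hcont {f : ℝ → ℝ} (hf : Continuous f) := HasUnifExpansion.of_continuousOn hS
      hf.continuousOn m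
    have hs : HasUnifExpansion (Set.Icc 0 Real.pi) m fun ε θ => radialFactor V θ * U ε θ :=
      (hcont (contDiff_radialFactor hb).continuous).mul hS ih
    have hsA : ∀ᶠ ε in 𝓝[≠] (0 : ℝ), ∀ θ ∈ Set.Icc 0 Real.pi,
        0 < radialFactor V θ * U ε θ ∧ radialFactor V θ * U ε θ ≤ A * (3 / 2) := by
      filter_upwards [hU] with ε h θ hθ
      have h1 := (h.2 θ hθ).1
      have h2 : 0 < U ε θ := lt_of_lt_of_le (by norm_num) h1.1
      exact ⟨mul_pos (radialFactor_pos V θ) h2, mul_le_mul (hρA θ hθ) h1.2 h2.le hA.le⟩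
    have hsin' : ∀ θ : ℝ, |-Real.sin θ| ≤ 1 := fun θ => by
      rw [abs_neg]; exact Real.abs_sin_le_one θ
    have hα := HasUnifExpansion.polarRem hS hV h0 Real.continuous_cos Real.continuous_sin
      Real.abs_cos_le_one Real.abs_sin_le_one hs hsA
    have hβ := HasUnifExpansion.polarRem (c₁ := fun θ => -Real.sin θ) hS hV h0 Real.continuous_sin.neg Real.continuous_cos
      hsin' Real.abs_cos_le_one hs hsA
    have hden := ((hcont (continuous_angularComp_fderiv V)).add
      ((hs.eps_mul.of_succ hS).mul hS hβ)).inv hS hc (by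
        filter_upwards [hev, hU] with ε h1 h2 θ hθ
        exact (h1 θ hθ _ (h2.2 θ hθ).1).1.trans (le_abs_self _))
    have hKexp := (((ih.mul hS hs).mul hS ((hα.mul hS (hcont (continuous_angularComp_fderiv V))).add
      ((hcont (continuous_radialComp_fderiv V).neg).mul hS hβ))).mul hS (hcont
      ((continuous_angularComp_fderiv V).inv₀ fun θ => (hb θ).ne'))).mul hS hden
    have hK : HasUnifExpansion (Set.Icc 0 Real.pi) m
        fun ε θ => angularRhs V ε θ (U ε θ) / ε := by
      refine hKexp.congr ?_
      filter_upwards [hev, hU, self_mem_nhdsWithin] with ε h1 h2 (hε : ε ≠ 0) θ hθ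
      have h3 := (h2.2 θ hθ).1
      have h4 : 0 < U ε θ := lt_of_lt_of_le (by norm_num) h3.1
      rw [angularRhs_eq hb hε h4.ne' (hc.trans_le (h1 θ hθ _ h3).1).ne', mul_div_cancel_left₀ _ hε]
      simp only [Pi.neg_apply, Pi.inv_apply]
      ring
    have hrc : ∀ᶠ ε in 𝓝[≠] (0 : ℝ),
        ContinuousOn (fun θ => angularRhs V ε θ (U ε θ)) (Set.Icc 0 Real.pi) := by
      filter_upwards [hU, contDiffOn_angularRhs hb hV h0] with ε h1 h2
      exact h2.continuousOn.comp (f := fun θ : ℝ => (θ, U ε θ))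
        (continuousOn_id.prodMk fun θ hθ => (h1.2 θ hθ).2.continuousWithinAt)
        fun θ hθ => ⟨hθ, (h1.2 θ hθ).1⟩
    refine ⟨fun _ => 1, continuousOn_const, _,
      hK.integral (hrc.mono fun ε h => h.div_const ε), ?_⟩
    filter_upwards [hU, hrc, self_mem_nhdsWithin] with ε h1 h2 (hε : ε ≠ 0) θ hθ
    have hsub : Set.Icc 0 θ ⊆ Set.Icc 0 Real.pi := Set.Icc_subset_Icc_right hθ.2
    rw [intervalIntegral.integral_div, mul_div_cancel₀ _ hε,
      intervalIntegral.integral_eq_sub_of_hasDerivAt_of_le hθ.1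
        (fun s hs => ((h1.2 s (hsub hs)).2.continuousWithinAt).mono hsub)
        (fun s hs => (h1.2 s ⟨hs.1.le, hs.2.le.trans hθ.2⟩).2.hasDerivAt
          (Icc_mem_nhds hs.1 (hs.2.trans_le hθ.2)))
        ((h2.mono hsub).intervalIntegrable_of_Icc hθ.1), h1.1]
    ring

/-- Near a non-degenerate monodromic singularity with counter-clockwise flow, the half return map
is defined, and it has Taylor expansions of all orders. -/
theorem exists_halfReturn : ∃ (φ : ℝ → ℝ) (C : ℝ),
    (∀ᶠ x in 𝓝[≠] (0 : ℝ), HalfReturn V C x (φ x)) ∧ HasTaylorPolynomials φ := by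
  obtain ⟨U, hU⟩ := exists_solution_angularRhs hb hV h0
  obtain ⟨A, c, Q, hA, hc, hQ, hρA, hev⟩ := exists_angularRhs_bounds hb hV h0
  have hπ : Real.pi ∈ Set.Icc 0 Real.pi := ⟨Real.pi_pos.le, le_rfl⟩
  -- The parameter ε is the abscissa `x` itself. For `x < 0` the polar radius is negative and the
  -- same angles 0 to π describe the lower half turn, so one formula covers both sides.
  refine ⟨fun x => -(x * (radialFactor V Real.pi * U x Real.pi)), A * (3 / 2), ?_, fun m => ?_⟩
  · filter_upwards [hU, hev, self_mem_nhdsWithin] with x h1 h2 (hx : x ≠ 0)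
    obtain ⟨hU0, hU1⟩ := h1
    have hUpos : ∀ θ ∈ Set.Icc 0 Real.pi, 0 < radialFactor V θ * U x θ := fun θ hθ =>
      mul_pos (radialFactor_pos V θ) (lt_of_lt_of_le (by norm_num) (hU1 θ hθ).1.1)
    -- In polar coordinates dθ/dt = D/r, so the speed factor of the orbit parametrized by the angle
    -- is r/D. It is positive for either sign of r because D is r times a positive quantity.
    set D : ℝ → ℝ := fun θ => angularComp V θ (x * (radialFactor V θ * U x θ)) with hD
    have hDeq : ∀ θ ∈ Set.Icc 0 Real.pi, ∃ d, c ≤ d ∧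
        D θ = x * (radialFactor V θ * U x θ) * d := fun θ hθ =>
      ⟨_, (h2 θ hθ _ (hU1 θ hθ).1).1,
        polarComp_eq _ _ V θ (mul_ne_zero hx (hUpos θ hθ).ne')⟩
    have hD0 : ∀ θ ∈ Set.Icc 0 Real.pi, D θ ≠ 0 := fun θ hθ => by
      obtain ⟨d, hd, e⟩ := hDeq θ hθ
      rw [e]
      exact mul_ne_zero (mul_ne_zero hx (hUpos θ hθ).ne') (hc.trans_le hd).ne'
    have hUc : ContinuousOn (U x) (Set.Icc 0 Real.pi) :=
      fun θ hθ => (hU1 θ hθ).2.continuousWithinAt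
    have hrc : ContinuousOn (fun θ => x * (radialFactor V θ * U x θ)) (Set.Icc 0 Real.pi) :=
      continuousOn_const.mul ((contDiff_radialFactor hb).continuous.continuousOn.mul hUc)
    have hΓc : ContinuousOn (fun θ => V ((x * (radialFactor V θ * U x θ)) •
        (Real.cos θ, Real.sin θ))) (Set.Icc 0 Real.pi) := by
      intro θ hθ
      have hV' := (h2 θ hθ _ (hU1 θ hθ).1).2.2.continuousAt
      refine ContinuousAt.comp_continuousWithinAt (g := V) hV' ?_
      exact (hrc θ hθ).smul (Continuous.continuousWithinAt (by fun_prop))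
    have hDc : ContinuousOn D (Set.Icc 0 Real.pi) :=
      (Real.continuous_sin.neg.continuousOn.mul hΓc.fst).add
        (Real.continuous_cos.continuousOn.mul hΓc.snd)
    have hgpos : ∀ θ ∈ Set.Icc 0 Real.pi, 0 < x * (radialFactor V θ * U x θ) / D θ := by
      intro θ hθ
      obtain ⟨d, hd, e⟩ := hDeq θ hθ
      rw [e, div_mul_cancel_left₀ (mul_ne_zero hx (hUpos θ hθ).ne')]
      exact inv_pos.2 (hc.trans_le hd)
    refine ⟨?_, fun θ => (x * (radialFactor V θ * U x θ)) • (Real.cos θ, Real.sin θ),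
      fun θ => x * (radialFactor V θ * U x θ) / D θ, Real.pi, Real.pi_pos,
      ⟨hrc.div hDc hD0, ?_, ?_⟩, hgpos, ?_, ?_, ?_, ?_⟩
    · have := mul_pos (mul_self_pos.2 hx) (hUpos Real.pi hπ)
      linarith
    · exact fun θ hθ => hgpos θ ⟨hθ.1.le, hθ.2.le⟩
    · intro θ hθ
      have hr := ((hasDerivAt_radialFactor hb θ).hasDerivWithinAt.mul
        (hU1 θ hθ).2).const_mul x
      have he : HasDerivWithinAt (fun θ => ((Real.cos θ, Real.sin θ) : ℝ × ℝ))
          (-Real.sin θ, Real.cos θ) (Set.Icc 0 Real.pi) θ :=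
        ((Real.hasDerivAt_cos θ).prodMk (Real.hasDerivAt_sin θ)).hasDerivWithinAt
      have hΓ := hr.smul he
      refine hΓ.congr_deriv ?_
      have hDθ := hD0 θ hθ
      have hbθ := (hb θ).ne'
      have hcs := Real.cos_sq_add_sin_sq θ
      simp only [Pi.mul_apply]
      rw [angularRhs]
      simp only [hD] at hDθ ⊢
      have hN1 : radialComp V θ (x * (radialFactor V θ * U x θ)) =
        Real.cos θ * (V ((x * (radialFactor V θ * U x θ)) • (Real.cos θ, Real.sin θ))).1 +
        Real.sin θ * (V ((x * (radialFactor V θ * U x θ)) • (Real.cos θ, Real.sin θ))).2 := rfl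
      have hN2 : angularComp V θ (x * (radialFactor V θ * U x θ)) =
        -Real.sin θ * (V ((x * (radialFactor V θ * U x θ)) • (Real.cos θ, Real.sin θ))).1 +
        Real.cos θ * (V ((x * (radialFactor V θ * U x θ)) • (Real.cos θ, Real.sin θ))).2 := rfl
      generalize V ((x * (radialFactor V θ * U x θ)) • (Real.cos θ, Real.sin θ)) = v at *
      generalize radialComp V θ (x * (radialFactor V θ * U x θ)) = N₁ at *
      generalize angularComp V θ (x * (radialFactor V θ * U x θ)) = N₂ at *
      generalize radialComp (fderiv ℝ V 0) θ 1 = a at *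
      generalize angularComp (fderiv ℝ V 0) θ 1 = b at *
      generalize radialFactor V θ = ρ at *
      generalize U x θ = u at *
      have hv1 : v.1 = Real.cos θ * N₁ - Real.sin θ * N₂ := by
        rw [hN1, hN2]; linear_combination (-v.1) * hcs
      have hv2 : v.2 = Real.sin θ * N₁ + Real.cos θ * N₂ := by
        rw [hN1, hN2]; linear_combination (-v.2) * hcs
      clear hN1 hN2
      ext
      · simp only [Prod.fst_add, Prod.smul_fst, smul_eq_mul, hv1]
        field_simp
        ring
      · simp only [Prod.snd_add, Prod.smul_snd, smul_eq_mul, hv2]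
        field_simp
        ring
    · simp [radialFactor_zero, hU0]
    · simp
    · intro θ hθ
      have hθ' : θ ∈ Set.Icc 0 Real.pi := ⟨hθ.1.le, hθ.2.le⟩
      have h3 := mul_pos (mul_pos (mul_self_pos.2 hx) (hUpos θ hθ'))
        (Real.sin_pos_of_pos_of_lt_pi hθ.1 hθ.2)
      simp only [Prod.smul_snd, smul_eq_mul]
      linarith
    · intro θ hθ
      refine (norm_smul_cos_sin_le _ θ).trans ?_
      rw [abs_mul, abs_of_pos (hUpos θ hθ), mul_comm]
      refine mul_le_mul_of_nonneg_right ?_ (abs_nonneg x)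
      exact mul_le_mul (hρA θ hθ) (hU1 θ hθ).1.2
        (le_trans (by norm_num) (hU1 θ hθ).1.1) hA.le
  · have hexp := ((HasUnifExpansion.of_continuousOn isCompact_Icc
      (contDiff_radialFactor hb).continuous.neg.continuousOn m).mul isCompact_Icc
      (hasUnifExpansion_solution hb hV h0 hU m)).eps_mul.of_succ isCompact_Icc
    obtain ⟨p, hp⟩ := hexp.exists_polynomial hπ
    refine ⟨p, hp.congr' (Eventually.of_forall fun x => ?_) EventuallyEq.rfl⟩
    simp only [Pi.neg_apply]
    ring

end HalfReturn

/-! ### Compositions of jets at the origin. -/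

section PolynomialComposition

open Polynomial

theorem Polynomial.X_pow_succ_dvd_of_isLittleO {q : ℝ[X]} {n : ℕ}
    (h : (fun x : ℝ => q.eval x) =o[𝓝[>] 0] fun x => x ^ n) : X ^ (n + 1) ∣ q := by
  have base : ∀ {r : ℝ[X]}, Tendsto (fun x : ℝ => r.eval x) (𝓝[>] 0) (𝓝 0) → X ∣ r := by
    intro r hr
    rw [X_dvd_iff, coeff_zero_eq_eval_zero]
    exact tendsto_nhds_unique ((r.continuous.tendsto 0).mono_left nhdsWithin_le_nhds) hr
  induction n with
  | zero =>
    rw [zero_add, pow_one]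
    refine base ?_
    simpa [isLittleO_one_iff] using h
  | succ n ih =>
    have h1 : (fun x : ℝ => x ^ (n + 1)) =O[𝓝[>] 0] fun x => x ^ n := by
      have : (fun x : ℝ => x ^ (n + 1)) =O[𝓝 0] fun x => x ^ n :=
        (isLittleO_pow_pow (Nat.lt_succ_self n)).isBigO
      exact this.mono nhdsWithin_le_nhds
    obtain ⟨r, rfl⟩ := ih (h.trans_isBigO h1)
    rw [pow_succ (X : ℝ[X]) (n + 1)]
    refine mul_dvd_mul_left _ (base ?_)
    have h2 := h.tendsto_div_nhds_zero
    refine h2.congr' ?_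
    filter_upwards [self_mem_nhdsWithin] with x (hx : 0 < x)
    rw [eval_mul, eval_pow, eval_X, mul_div_cancel_left₀ _ (pow_ne_zero _ hx.ne')]

theorem Polynomial.sub_dvd_comp_sub_comp (p q r : ℝ[X]) : q - r ∣ p.comp q - p.comp r := by
  simpa [comp, eval_map] using sub_dvd_eval_sub q r (p.map C)

theorem Polynomial.eval_derivative_zero_of_dvd {p : ℝ[X]} (h : X ^ 2 ∣ p) :
    p.derivative.eval 0 = 0 := by
  obtain ⟨r, rfl⟩ := h
  simp

/-- The local computation behind the parity of the order of a pseudo focus: `p₁`, `p₂` are jets of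
half return maps, `p₂` is an involution and `p₂ ∘ p₁ = x + α xⁿ + ⋯`. -/
theorem comp_self_of_comp_involution {p₁ p₂ : ℝ[X]} {n : ℕ} (hn : 2 ≤ n) {α : ℝ}
    (h1 : p₁.eval 0 = 0) (h2' : p₂.derivative.eval 0 = -1)
    (h22 : X ^ (n + 1) ∣ p₂.comp p₂ - X)
    (h21 : X ^ (n + 1) ∣ p₂.comp p₁ - X - C α * X ^ n) :
    X ^ (n + 1) ∣ p₁.comp p₁ - X - C (α * (1 - (-1) ^ n)) * X ^ n := by
  have hX1 : (X : ℝ[X]) ∣ p₁ := by rw [X_dvd_iff, coeff_zero_eq_eval_zero, h1]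
  -- the linear coefficient of `p₁`
  have h1' : p₁.derivative.eval 0 = -1 := by
    have h := eval_derivative_zero_of_dvd ((pow_dvd_pow X (by omega : 2 ≤ n + 1)).trans h21)
    simp only [derivative_sub, derivative_comp, derivative_X, derivative_C_mul, derivative_X_pow,
      eval_sub, eval_mul, eval_comp, h1, h2', eval_C, eval_one, eval_pow, eval_X,
      zero_pow (by omega : n - 1 ≠ 0)] at h
    linarith
  -- `p₁ ≡ p₂ - α Xⁿ`
  have key : X ^ (n + 1) ∣ p₁ - (p₂ - C α * X ^ n) := by
    -- Substituting `p₁` in the involution identity preserves the order of the error, since `p₁` is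
    -- divisible by `X`.
    have e1 : X ^ (n + 1) ∣ p₂.comp (p₂.comp p₁) - p₁ := by
      obtain ⟨r, hr⟩ := h22
      have : p₂.comp (p₂.comp p₁) - p₁ = p₁ ^ (n + 1) * r.comp p₁ := by
        have := congrArg (fun q => q.comp p₁) hr
        simpa [comp_assoc] using this
      rw [this]
      exact (pow_dvd_pow_of_dvd hX1 _).mul_right _
    have e2 : X ^ (n + 1) ∣ p₂.comp (p₂.comp p₁) - p₂.comp (X + C α * X ^ n) := by
      refine dvd_trans ?_ (sub_dvd_comp_sub_comp p₂ _ _)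
      rwa [← sub_sub]
    -- First order Taylor expansion: `p₂'` is -1 modulo `X`, and the quadratic term has order 2n ≥ n
    -- + 1 because n ≥ 2.
    have e3 : X ^ (n + 1) ∣ p₂.comp (X + C α * X ^ n) - (p₂ - C α * X ^ n) := by
      obtain ⟨k, hk⟩ := binomExpansion (p₂.map C) X (C α * X ^ n)
      have hk' : p₂.comp (X + C α * X ^ n) =
          p₂ + p₂.derivative * (C α * X ^ n) + k * (C α * X ^ n) ^ 2 := by
        have e : ∀ p q : ℝ[X], (p.map C).eval q = p.comp q := fun p q => by
          rw [comp, eval_map]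
        rw [derivative_map, e, e, e, comp_X, comp_X] at hk
        exact hk
      have hd : X ∣ p₂.derivative + 1 := by
        rw [X_dvd_iff, coeff_zero_eq_eval_zero, eval_add, eval_one, h2']
        norm_num
      obtain ⟨d, hd⟩ := hd
      have : p₂.comp (X + C α * X ^ n) - (p₂ - C α * X ^ n) =
          X ^ (n + 1) * (d * C α) + X ^ (2 * n) * (k * C α ^ 2) := by
        rw [hk', pow_mul', pow_succ]
        linear_combination (C α * X ^ n) * hd
      rw [this]
      exact dvd_add (dvd_mul_right _ _) ((pow_dvd_pow X (by omega)).mul_right _)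
    have := (e2.add e3).sub e1
    ring_nf at this ⊢
    exact this
  have e4 : X ^ (n + 1) ∣ p₁.comp p₁ - (p₂.comp p₁ - C α * p₁ ^ n) := by
    obtain ⟨r, hr⟩ := key
    have : p₁.comp p₁ - (p₂.comp p₁ - C α * p₁ ^ n) = p₁ ^ (n + 1) * r.comp p₁ := by
      have := congrArg (fun q => q.comp p₁) hr
      simpa using this
    rw [this]
    exact (pow_dvd_pow_of_dvd hX1 _).mul_right _
  have e5 : X ^ (n + 1) ∣ p₁ ^ n - C ((-1) ^ n) * X ^ n := by
    obtain ⟨A, rfl⟩ := hX1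
    have hA : A.eval 0 = -1 := by simpa using h1'
    have : (X * A) ^ n - C ((-1) ^ n) * X ^ n = X ^ n * (A ^ n - C ((-1) ^ n)) := by
      rw [mul_pow]; ring
    rw [this, pow_succ]
    refine mul_dvd_mul_left _ ?_
    rw [X_dvd_iff, coeff_zero_eq_eval_zero, eval_sub, eval_pow, hA, eval_C, sub_self]
  -- Thus p₁ ∘ p₁ ≡ p₂ ∘ p₁ - α p₁ⁿ ≡ X + α Xⁿ - α (-1)ⁿ Xⁿ.
  have := (e4.add h21).sub (e5.mul_left (C α))
  convert this using 1
  simp only [C_mul, C_sub, C_1]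
  ring

end PolynomialComposition

/-! ### From asymptotics of maps to congruences of jets. -/

section Asymptotics

open Polynomial

/-- A Taylor polynomial of a map exchanging the two sides of `0` vanishes at `0` and is
nonincreasing there. -/
theorem taylor_of_mul_neg {φ : ℝ → ℝ} {p : ℝ[X]} {m : ℕ} (hm : 2 ≤ m)
    (hp : (fun x => φ x - p.eval x) =O[𝓝[≠] 0] fun x : ℝ => x ^ m)
    (hs : ∀ᶠ x in 𝓝[≠] (0 : ℝ), x * φ x < 0) :
    p.eval 0 = 0 ∧ p.derivative.eval 0 ≤ 0 ∧ Tendsto φ (𝓝[≠] 0) (𝓝[≠] 0) := by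
  have hO : (fun x => φ x - p.eval x) =o[𝓝[≠] 0] fun x : ℝ => x := by
    refine hp.trans_isLittleO ?_
    have : (fun x : ℝ => x ^ m) =o[𝓝 0] fun x => x ^ 1 := isLittleO_pow_pow (by omega)
    simpa using this.mono nhdsWithin_le_nhds
  have hid : Tendsto (fun x : ℝ => x) (𝓝[≠] 0) (𝓝 0) := tendsto_id.mono_left nhdsWithin_le_nhds
  have hlim : Tendsto φ (𝓝[≠] 0) (𝓝 (p.eval 0)) := by
    have h1 : Tendsto (fun x => p.eval x) (𝓝[≠] 0) (𝓝 (p.eval 0)) :=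
      (p.continuous.tendsto 0).mono_left nhdsWithin_le_nhds
    have := (hO.trans_tendsto hid).add h1
    simpa using this
  have hpos : ∀ᶠ x in 𝓝[>] (0 : ℝ), φ x < 0 := by
    filter_upwards [hs.filter_mono (nhdsWithin_mono 0 fun x (hx : 0 < x) => hx.ne'),
      self_mem_nhdsWithin] with x h1 (h2 : 0 < x)
    exact neg_of_mul_neg_right h1 h2.le
  have hneg : ∀ᶠ x in 𝓝[<] (0 : ℝ), 0 < φ x := by
    filter_upwards [hs.filter_mono (nhdsWithin_mono 0 fun x (hx : x < 0) => hx.ne),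
      self_mem_nhdsWithin] with x h1 (h2 : x < 0)
    exact pos_of_mul_neg_right h1 h2.le
  have hp0 : p.eval 0 = 0 := by
    refine le_antisymm (le_of_tendsto (hlim.mono_left (nhdsWithin_mono 0
      (show Set.Ioi (0 : ℝ) ⊆ {0}ᶜ from fun x hx => hx.ne'))) (hpos.mono fun x h => h.le)) ?_
    exact ge_of_tendsto (hlim.mono_left (nhdsWithin_mono 0
      (show Set.Iio (0 : ℝ) ⊆ {0}ᶜ from fun x hx => hx.ne))) (hneg.mono fun x h => h.le)
  rw [hp0] at hlim
  refine ⟨hp0, ?_, tendsto_nhdsWithin_iff.2 ⟨hlim, ?_⟩⟩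
  · have h1 : Tendsto (fun x => x⁻¹ * p.eval x) (𝓝[≠] 0) (𝓝 (p.derivative.eval 0)) := by
      have := hasDerivAt_iff_tendsto_slope.1 (p.hasDerivAt 0)
      refine this.congr fun x => ?_
      simp [slope, hp0]
    have h2 := hO.tendsto_div_nhds_zero.add h1
    rw [zero_add] at h2
    refine le_of_tendsto h2 ?_
    filter_upwards [hs, self_mem_nhdsWithin] with x h3 (h4 : x ≠ 0)
    have : (φ x - p.eval x) / x + x⁻¹ * p.eval x = x * φ x / x ^ 2 := by
      field_simp
      ring
    rw [this]
    exact div_nonpos_of_nonpos_of_nonneg h3.le (sq_nonneg x)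
  · filter_upwards [hs] with x h3 (h4 : φ x = 0)
    simp [h4] at h3

/-- The error splits as (φ - p) at ψ(x), controlled because ψ(x) = O(x), plus p(ψ) - p(q),
controlled because polynomials are locally Lipschitz. The sign condition on `ψ` ensures that it
tends to 0 without taking the value 0. -/
theorem isBigO_comp_sub_comp {φ ψ : ℝ → ℝ} {p q : ℝ[X]} {m : ℕ} (hm : 2 ≤ m)
    (hp : (fun x => φ x - p.eval x) =O[𝓝[≠] 0] fun x : ℝ => x ^ m)
    (hq : (fun x => ψ x - q.eval x) =O[𝓝[≠] 0] fun x : ℝ => x ^ m)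
    (hψ : ∀ᶠ x in 𝓝[≠] (0 : ℝ), x * ψ x < 0) :
    (fun x => φ (ψ x) - (p.comp q).eval x) =O[𝓝[≠] 0] fun x : ℝ => x ^ m := by
  obtain ⟨hq0, -, hlim⟩ := taylor_of_mul_neg hm hq hψ
  have hqO : (fun x => q.eval x) =O[𝓝[≠] 0] fun x : ℝ => x := by
    have := (q.hasDerivAt 0).hasFDerivAt.isBigO_sub
    simpa [hq0] using this.mono (nhdsWithin_le_nhds (s := {0}ᶜ))
  have hψO : ψ =O[𝓝[≠] 0] fun x : ℝ => x := by
    have h1 : (fun x : ℝ => x ^ m) =O[𝓝[≠] 0] fun x => x := by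
      have : (fun x : ℝ => x ^ m) =o[𝓝 0] fun x => x ^ 1 := isLittleO_pow_pow (by omega)
      simpa using (this.mono nhdsWithin_le_nhds).isBigO
    simpa using (hq.trans h1).add hqO
  have e1 : (fun x => φ (ψ x) - p.eval (ψ x)) =O[𝓝[≠] 0] fun x : ℝ => x ^ m :=
    (hp.comp_tendsto hlim).trans (hψO.pow m)
  have e2 : (fun x => p.eval (ψ x) - p.eval (q.eval x)) =O[𝓝[≠] 0] fun x : ℝ => x ^ m := by
    have hstrict := (p.hasStrictDerivAt 0).isBigO_sub
    have hpair : Tendsto (fun x => (ψ x, q.eval x)) (𝓝[≠] 0) (𝓝 ((0 : ℝ), (0 : ℝ))) := by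
      refine (hlim.mono_right nhdsWithin_le_nhds).prodMk_nhds ?_
      exact ((q.continuous.tendsto' 0 0 hq0)).mono_left nhdsWithin_le_nhds
    exact (hstrict.comp_tendsto hpair).trans hq
  refine (e1.add e2).congr_left fun x => ?_
  rw [eval_comp]
  ring

theorem dvd_comp_sub_of_isLittleO {φ ψ : ℝ → ℝ} {p q : ℝ[X]} {m n : ℕ} (hm : 2 ≤ m) (hnm : n < m)
    (hp : (fun x => φ x - p.eval x) =O[𝓝[≠] 0] fun x : ℝ => x ^ m)
    (hq : (fun x => ψ x - q.eval x) =O[𝓝[≠] 0] fun x : ℝ => x ^ m)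
    (hψ : ∀ᶠ x in 𝓝[≠] (0 : ℝ), x * ψ x < 0) {α : ℝ}
    (h : (fun x => φ (ψ x) - x - α * x ^ n) =o[𝓝[>] 0] fun x => x ^ n) :
    X ^ (n + 1) ∣ p.comp q - X - C α * X ^ n := by
  refine X_pow_succ_dvd_of_isLittleO ?_
  have h1 := (isBigO_comp_sub_comp hm hp hq hψ).mono
    (nhdsWithin_mono 0 fun x (hx : 0 < x) => hx.ne')
  have h2 : (fun x : ℝ => x ^ m) =o[𝓝[>] 0] fun x => x ^ n :=
    (isLittleO_pow_pow hnm).mono nhdsWithin_le_nhds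
  refine (h.sub (h1.trans_isLittleO h2)).congr_left fun x => ?_
  simp
  ring

theorem not_X_pow_succ_dvd {c : ℝ} (hc : c ≠ 0) (n : ℕ) : ¬ X ^ (n + 1) ∣ C c * (X : ℝ[X]) ^ n := by
  intro h
  have := X_pow_dvd_iff.1 h n (Nat.lt_succ_self n)
  simp at this
  exact hc this

theorem order_of_involution_comp {φ₁ φ₂ : ℝ → ℝ} (e₁ : HasTaylorPolynomials φ₁)
    (e₂ : HasTaylorPolynomials φ₂) (s₁ : ∀ᶠ x in 𝓝[≠] (0 : ℝ), x * φ₁ x < 0)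
    (s₂ : ∀ᶠ x in 𝓝[≠] (0 : ℝ), x * φ₂ x < 0) (hinv : ∀ᶠ x in 𝓝[>] (0 : ℝ), φ₂ (φ₂ x) = x)
    {n k : ℕ} (hn : 1 ≤ n) {α β : ℝ} (hα : α ≠ 0) (hβ : β ≠ 0)
    (h21 : (fun x => φ₂ (φ₁ x) - x - α * x ^ n) =o[𝓝[>] 0] fun x => x ^ n)
    (h11 : (fun x => φ₁ (φ₁ x) - x - β * x ^ (2 * k + 1)) =o[𝓝[>] 0] fun x => x ^ (2 * k + 1)) :
    n = 2 * k + 1 ∨ (Even n ∧ n < 2 * k + 1) := by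
  -- The precision n + 2k + 1 exceeds both orders to be compared and is at least 2.
  obtain ⟨p₁, hp₁⟩ := e₁ (n + (2 * k + 1))
  obtain ⟨p₂, hp₂⟩ := e₂ (n + (2 * k + 1))
  have hm : 2 ≤ n + (2 * k + 1) := by omega
  obtain ⟨z₁, d₁, -⟩ := taylor_of_mul_neg hm hp₁ s₁
  obtain ⟨z₂, d₂, -⟩ := taylor_of_mul_neg hm hp₂ s₂
  have c21 := dvd_comp_sub_of_isLittleO hm (by omega) hp₂ hp₁ s₁ h21
  have c11 := dvd_comp_sub_of_isLittleO hm (by omega) hp₁ hp₁ s₁ h11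
  have c22 : X ^ (n + 1) ∣ p₂.comp p₂ - X := by
    have : (fun x => φ₂ (φ₂ x) - x - 0 * x ^ n) =o[𝓝[>] 0] fun x : ℝ => x ^ n := by
      refine (isLittleO_zero (fun x : ℝ => x ^ n) (𝓝[>] (0 : ℝ))).congr' ?_ EventuallyEq.rfl
      filter_upwards [hinv] with x hx
      rw [hx]
      ring
    simpa using dvd_comp_sub_of_isLittleO hm (by omega) hp₂ hp₂ s₂ this
  have hsq : ∀ d : ℝ, d ≤ 0 → d * d = 1 → d = -1 := fun d h0 h1 => by nlinarith
  have hd₂ : p₂.derivative.eval 0 = -1 := by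
    refine hsq _ d₂ ?_
    have h := eval_derivative_zero_of_dvd ((pow_dvd_pow X (by omega : 2 ≤ n + 1)).trans c22)
    simp only [derivative_sub, derivative_comp, derivative_X, eval_sub, eval_mul, eval_comp, z₂,
      eval_one] at h
    linarith
  -- For n = 1 and k > 0 both slopes are -1, so the composition has slope 1 and α would vanish.
  rcases hn.eq_or_lt with rfl | hn2
  · refine Or.inl ?_
    by_contra hk
    have hd₁ : p₁.derivative.eval 0 = -1 := by
      refine hsq _ d₁ ?_
      have h := eval_derivative_zero_of_dvd ((pow_dvd_pow X (by omega)).trans c11)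
      simp only [derivative_sub, derivative_comp, derivative_X, derivative_C_mul,
        derivative_X_pow, eval_sub, eval_mul, eval_comp, z₁, eval_one, eval_pow, eval_X, eval_C,
        zero_pow (by omega : 2 * k + 1 - 1 ≠ 0)] at h
      linarith
    have h := eval_derivative_zero_of_dvd c21
    simp only [derivative_sub, derivative_comp, derivative_X, derivative_C_mul,
      pow_one, eval_sub, eval_mul, eval_comp, z₁, hd₁, hd₂, eval_one, eval_C] at h
    exact hα (by linarith)
  have c11' := comp_self_of_comp_involution hn2 z₁ hd₂ c22 c21
  -- For even n the coefficient 1 - (-1)ⁿ is 0, so `p₁ ∘ p₁` is the identity through order n and the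
  -- focus must have larger order.
  have hge : Even n → n < 2 * k + 1 := by
    intro hev
    by_contra hlt
    rw [hev.neg_one_pow, sub_self, mul_zero, C_0, zero_mul, sub_zero] at c11'
    refine not_X_pow_succ_dvd hβ (2 * k + 1) ?_
    simpa using ((pow_dvd_pow X (by omega : 2 * k + 1 + 1 ≤ n + 1)).trans c11').sub c11
  rcases Nat.even_or_odd n with hev | hodd
  · exact Or.inr ⟨hev, hge hev⟩
  refine Or.inl ?_
  rw [hodd.neg_one_pow] at c11'
  have hγ : α * (1 - -1) ≠ 0 := mul_ne_zero hα (by norm_num)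
  rcases lt_trichotomy n (2 * k + 1) with hlt | heq | hgt
  · refine absurd ?_ (not_X_pow_succ_dvd hγ n)
    have h1 : X ^ (n + 1) ∣ C β * (X : ℝ[X]) ^ (2 * k + 1) := (pow_dvd_pow X hlt).mul_left _
    have := (((pow_dvd_pow X (by omega : n + 1 ≤ 2 * k + 1 + 1)).trans c11).sub c11').add h1
    convert this using 1
    ring
  · exact heq
  · refine absurd ?_ (not_X_pow_succ_dvd hβ (2 * k + 1))
    have h1 : X ^ (2 * k + 1 + 1) ∣ C (α * (1 - -1)) * (X : ℝ[X]) ^ n :=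
      (pow_dvd_pow X hgt).mul_left _
    have := (((pow_dvd_pow X (by omega : 2 * k + 1 + 1 ≤ n + 1)).trans c11').sub c11).add h1
    convert this using 1
    ring

end Asymptotics

/-! ### Monodromic singularities, the lower involution and necessity. -/

theorem AnalyticAt.exists_lipschitzOnWith_ball {V : ℝ × ℝ → ℝ × ℝ} (hV : AnalyticAt ℝ V 0) :
    ∃ (K : NNReal) (r : ℝ), 0 < r ∧ LipschitzOnWith K V (Metric.ball 0 r) := by
  obtain ⟨K, t, ht, hK⟩ := hV.contDiffAt.exists_lipschitzOnWith
  obtain ⟨r, hr, hsub⟩ := Metric.mem_nhds_iff.1 ht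
  exact ⟨K, r, hr, hK.mono hsub⟩

theorem HasDerivWithinAt.fst_snd {γ : ℝ → ℝ × ℝ} {v : ℝ × ℝ} {S : Set ℝ} {t : ℝ}
    (h : HasDerivWithinAt γ v S t) : HasDerivWithinAt (fun t => (γ t).1) v.1 S t ∧
      HasDerivWithinAt (fun t => (γ t).2) v.2 S t :=
  ⟨(ContinuousLinearMap.fst ℝ ℝ ℝ).hasFDerivAt.comp_hasDerivWithinAt t h,
    (ContinuousLinearMap.snd ℝ ℝ ℝ).hasFDerivAt.comp_hasDerivWithinAt t h⟩

theorem eventually_mul_abs_lt (C : ℝ) {r : ℝ} (hr : 0 < r) :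
    ∀ᶠ x in 𝓝[≠] (0 : ℝ), C * |x| < r :=
  (((continuous_const.mul continuous_abs).tendsto' (0 : ℝ) 0 (by simp)).eventually_lt_const
    hr).filter_mono nhdsWithin_le_nhds

theorem nhdsGT_zero_le_nhdsNE : 𝓝[>] (0 : ℝ) ≤ 𝓝[≠] 0 :=
  nhdsWithin_mono 0 fun _ hx => ne_of_gt hx

theorem nhdsLT_zero_le_nhdsNE : 𝓝[<] (0 : ℝ) ≤ 𝓝[≠] 0 :=
  nhdsWithin_mono 0 fun _ hx => ne_of_lt hx

section Monodromic

variable {V : ℝ × ℝ → ℝ × ℝ}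

/-- If the angular component vanished in some direction, the linear part would map this direction to
a multiple of itself, which is a real eigenvalue. -/
theorem angularComp_fderiv_ne_zero (hV : HasNondegenerateMonodromicSingularity V) (θ : ℝ) :
    angularComp (fderiv ℝ V 0) θ 1 ≠ 0 := by
  intro h
  set L : ℝ × ℝ →ₗ[ℝ] ℝ × ℝ := (fderiv ℝ V 0 : ℝ × ℝ →ₗ[ℝ] ℝ × ℝ) with hL
  have hcs := Real.cos_sq_add_sin_sq θ
  set μ := radialComp (fderiv ℝ V 0) θ 1 with hμ
  have hvec : L (Real.cos θ, Real.sin θ) = μ • (Real.cos θ, Real.sin θ) := by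
    have h1 : μ = Real.cos θ * (L (Real.cos θ, Real.sin θ)).1 +
      Real.sin θ * (L (Real.cos θ, Real.sin θ)).2 := by
      simp only [hμ, polarComp, one_smul]; rfl
    have h2 : -Real.sin θ * (L (Real.cos θ, Real.sin θ)).1 +
      Real.cos θ * (L (Real.cos θ, Real.sin θ)).2 = 0 := by
      have h' := h
      simp only [angularComp, polarComp, one_smul] at h'
      exact h'
    generalize L (Real.cos θ, Real.sin θ) = w at h1 h2
    rw [h1]
    ext
    · simp only [Prod.smul_fst, smul_eq_mul]
      linear_combination (-w.1) * hcs - Real.sin θ * h2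
    · simp only [Prod.smul_snd, smul_eq_mul]
      linear_combination (-w.2) * hcs + Real.cos θ * h2
  have hne : ((Real.cos θ, Real.sin θ) : ℝ × ℝ) ≠ 0 := by
    intro h0
    rw [Prod.mk_eq_zero] at h0
    rw [h0.1, h0.2] at hcs
    norm_num at hcs
  have hev : Module.End.HasEigenvalue L μ :=
    Module.End.hasEigenvalue_of_hasEigenvector ⟨Module.End.mem_eigenspace_iff.2 hvec, hne⟩
  have hroot := (Module.End.hasEigenvalue_iff_isRoot_charpoly L μ).1 hev
  refine hV.2 (μ : ℂ) ?_ (Complex.ofReal_im μ)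
  have : Polynomial.aeval (algebraMap ℝ ℂ μ) L.charpoly = 0 := by
    rw [Polynomial.aeval_algebraMap_apply, Polynomial.coe_aeval_eq_eval, hroot.eq_zero, map_zero]
  exact this

theorem hasDerivAt_snd_axis (hd : DifferentiableAt ℝ V 0) :
    HasDerivAt (fun x : ℝ => (V (x, 0)).2) (fderiv ℝ V 0 (1, 0)).2 0 := by
  have h1 : HasDerivAt (fun x : ℝ => ((x, 0) : ℝ × ℝ)) (1, 0) 0 :=
    (hasDerivAt_id (0 : ℝ)).prodMk (hasDerivAt_const _ _)
  have h2 : HasFDerivAt V (fderiv ℝ V 0) ((fun x : ℝ => ((x, 0) : ℝ × ℝ)) 0) := hd.hasFDerivAt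
  exact (h2.comp_hasDerivAt (f := fun x : ℝ => ((x, 0) : ℝ × ℝ)) (0 : ℝ) h1).snd

theorem CrossesCounterclockwise.fderiv_nonneg (hc : CrossesCounterclockwise V)
    (hd : DifferentiableAt ℝ V 0) (h0 : (V 0).2 = 0) : 0 ≤ (fderiv ℝ V 0 (1, 0)).2 := by
  have h := hasDerivAt_iff_tendsto_slope.1 (hasDerivAt_snd_axis hd)
  refine ge_of_tendsto (h.mono_left nhdsGT_zero_le_nhdsNE) ?_
  filter_upwards [hc.filter_mono nhdsGT_zero_le_nhdsNE, self_mem_nhdsWithin] with x h1 (h2 : 0 < x)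
  rw [sign_pos h2, sign_eq_one_iff] at h1
  have h0' : (V ((0 : ℝ), (0 : ℝ))).2 = 0 := h0
  simp only [slope, h0', sub_zero, vsub_eq_sub, smul_eq_mul]
  positivity

/-- A continuous function of the angle without zeros has constant sign, and the crossing direction
of the axis fixes the sign at angle 0. -/
theorem angularComp_fderiv_pos (hV : HasNondegenerateMonodromicSingularity V)
    (hd : DifferentiableAt ℝ V 0) (hc : CrossesCounterclockwise V) (θ : ℝ) :
    0 < angularComp (fderiv ℝ V 0) θ 1 := by
  have h0 : 0 < angularComp (fderiv ℝ V 0) 0 1 := by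
    refine lt_of_le_of_ne ?_ (angularComp_fderiv_ne_zero hV 0).symm
    simpa [polarComp] using hc.fderiv_nonneg hd (by rw [hV.1]; rfl)
  by_contra hneg
  obtain ⟨θ', hθ'⟩ := mem_range_of_exists_le_of_exists_ge (continuous_angularComp_fderiv V)
    ⟨θ, not_lt.1 hneg⟩ ⟨0, h0.le⟩
  exact angularComp_fderiv_ne_zero hV θ' hθ'

/-- The first return map of a non-degenerate monodromic singularity is the second iterate of the
half return map. -/
theorem eventually_firstReturn_eq {φ : ℝ → ℝ} {C : ℝ} (hV : AnalyticAt ℝ V 0)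
    (hφ : ∀ᶠ x in 𝓝[≠] (0 : ℝ), HalfReturn V C x (φ x)) (hT : HasTaylorPolynomials φ) :
    ∀ᶠ x in 𝓝[>] (0 : ℝ), ∀ b, FirstReturn V x b → b = φ (φ x) := by
  obtain ⟨K, r, hr, hK⟩ := hV.exists_lipschitzOnWith_ball
  obtain ⟨p, hp⟩ := hT 2
  obtain ⟨-, -, hlim⟩ := taylor_of_mul_neg le_rfl hp (hφ.mono fun x h => h.1)
  have hsm := eventually_mul_abs_lt C hr
  filter_upwards [hφ.filter_mono nhdsGT_zero_le_nhdsNE, hsm.filter_mono nhdsGT_zero_le_nhdsNE,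
    (hlim.eventually hφ).filter_mono nhdsGT_zero_le_nhdsNE,
    (hlim.eventually hsm).filter_mono nhdsGT_zero_le_nhdsNE, self_mem_nhdsWithin]
    with x h1 h2 h3 h4 (h5 : 0 < x) b hb
  exact h1.eq_of_firstReturn h5 h3 hK h2 h4 hb

/-- `φ` is an involution with Taylor polynomials, exchanging the two sides of the origin, that
describes the transition of `V` through the lower half plane. -/
structure IsLowerInvolution (V : ℝ × ℝ → ℝ × ℝ) (φ : ℝ → ℝ) : Prop where
  taylor : HasTaylorPolynomials φ
  mul_neg : ∀ᶠ x in 𝓝[≠] (0 : ℝ), x * φ x < 0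
  invol : ∀ᶠ x in 𝓝[>] (0 : ℝ), φ (φ x) = x
  transition : ∀ᶠ c in 𝓝[<] (0 : ℝ), ∀ b, LowerTransition V c b → b = φ c

theorem HasCenter.exists_isLowerInvolution (hV : AnalyticAt ℝ V 0) (h : HasCenter V)
    (hc : CrossesCounterclockwise V) : ∃ φ, IsLowerInvolution V φ := by
  obtain ⟨φ, C, hφ, hT⟩ := exists_halfReturn
    (angularComp_fderiv_pos h.1 hV.differentiableAt hc) hV h.1.1
  obtain ⟨K, r, hr, hK⟩ := hV.exists_lipschitzOnWith_ball
  refine ⟨φ, hT, hφ.mono fun x h => h.1, ?_, ?_⟩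
  · filter_upwards [eventually_firstReturn_eq hV hφ hT, h.2] with x h1 h2
    exact (h1 x h2).symm
  · filter_upwards [hφ.filter_mono nhdsLT_zero_le_nhdsNE,
      (eventually_mul_abs_lt C hr).filter_mono nhdsLT_zero_le_nhdsNE] with c h1 h2 b hb
    exact h1.eq_of_lowerTransition hK h2 hb

/-- The pull-back, up to the factor `-2 y`, of `V` under the fold map `(x, y) ↦ (x, -y²)`. -/
def foldPullback (V : ℝ × ℝ → ℝ × ℝ) (z : ℝ × ℝ) : ℝ × ℝ :=
  (-2 * z.2 * (V (z.1, -z.2 ^ 2)).1, (V (z.1, -z.2 ^ 2)).2)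

theorem analyticAt_foldPullback (hV : AnalyticAt ℝ V 0) : AnalyticAt ℝ (foldPullback V) 0 := by
  have h1 : AnalyticAt ℝ (fun z : ℝ × ℝ => (z.1, -z.2 ^ 2)) 0 :=
    analyticAt_fst.prod (analyticAt_snd.pow 2).neg
  have e : ((0 : ℝ × ℝ).1, -(0 : ℝ × ℝ).2 ^ 2) = 0 := by ext <;> simp
  have h2 : AnalyticAt ℝ (fun z : ℝ × ℝ => V (z.1, -z.2 ^ 2)) 0 :=
    AnalyticAt.fun_comp (g := V) (by rwa [e]) h1
  have h3 : AnalyticAt ℝ (fun z : ℝ × ℝ => -2 * z.2) 0 := analyticAt_const.mul analyticAt_snd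
  exact (h3.mul (AnalyticAt.fun_comp analyticAt_fst h2)).prod
    (AnalyticAt.fun_comp analyticAt_snd h2)

/-- Reversibility: reflecting in the x-axis and reversing time maps trajectories to trajectories. -/
theorem foldPullback_reflect (V : ℝ × ℝ → ℝ × ℝ) (z : ℝ × ℝ) :
    foldPullback V (z.1, -z.2) = (-(foldPullback V z).1, (foldPullback V z).2) := by
  simp [foldPullback]

/-- Folding kills the y-derivative of `N` and turns the value `M(0,0)` into a linear term. The
resulting quadratic form is positive definite when both of its coefficients are positive, which a
contact crossed counter-clockwise guarantees. -/
theorem angularComp_fderiv_foldPullback (hV : AnalyticAt ℝ V 0) (θ : ℝ) :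
    angularComp (fderiv ℝ (foldPullback V) 0) θ 1 =
      2 * (V 0).1 * Real.sin θ ^ 2 + (fderiv ℝ V 0 (1, 0)).2 * Real.cos θ ^ 2 := by
  have hline : HasDerivAt (fun t : ℝ => t • ((Real.cos θ, Real.sin θ) : ℝ × ℝ))
      (Real.cos θ, Real.sin θ) 0 := by
    simpa using (hasDerivAt_id (0 : ℝ)).smul_const ((Real.cos θ, Real.sin θ) : ℝ × ℝ)
  have hW : HasFDerivAt (foldPullback V) (fderiv ℝ (foldPullback V) 0)
      ((0 : ℝ) • ((Real.cos θ, Real.sin θ) : ℝ × ℝ)) := by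
    rw [zero_smul]
    exact (analyticAt_foldPullback hV).differentiableAt.hasFDerivAt
  have h1 := hW.comp_hasDerivAt (0 : ℝ) hline
  have hin : HasDerivAt (fun t : ℝ => ((t * Real.cos θ, -(t * Real.sin θ) ^ 2) : ℝ × ℝ))
      (Real.cos θ, 0) 0 := by
    refine HasDerivAt.prodMk (by simpa using (hasDerivAt_id (0 : ℝ)).mul_const (Real.cos θ)) ?_
    have := (((hasDerivAt_id (0 : ℝ)).mul_const (Real.sin θ)).fun_pow 2).fun_neg
    simpa using this
  have hVd : HasFDerivAt V (fderiv ℝ V 0)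
      ((fun t : ℝ => ((t * Real.cos θ, -(t * Real.sin θ) ^ 2) : ℝ × ℝ)) 0) := by
    have e : (fun t : ℝ => ((t * Real.cos θ, -(t * Real.sin θ) ^ 2) : ℝ × ℝ)) 0 = 0 := by
      ext <;> simp
    rw [e]
    exact hV.differentiableAt.hasFDerivAt
  have hv := hVd.comp_hasDerivAt (0 : ℝ) hin
  have hlin : HasDerivAt (fun t : ℝ => -2 * (t * Real.sin θ)) (-2 * Real.sin θ) 0 := by
    simpa using ((hasDerivAt_id (0 : ℝ)).mul_const (Real.sin θ)).const_mul (-2)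
  have h2 := (hlin.mul hv.fst).prodMk hv.snd
  have h3 := h1.unique h2
  have hcos : fderiv ℝ V 0 (Real.cos θ, 0) = Real.cos θ • fderiv ℝ V 0 (1, 0) := by
    rw [← map_smul]
    simp
  have e : V (0, 0) = V 0 := rfl
  simp only [angularComp, polarComp, one_smul, h3, hcos]
  simp [e]
  ring

theorem HasParabolicContact.exists_isLowerInvolution (hV : AnalyticAt ℝ V 0)
    (h : HasParabolicContact V) (hc : CrossesCounterclockwise V) :
    ∃ φ, IsLowerInvolution V φ := by
  have hW := analyticAt_foldPullback hV
  have hV0 : (V 0).2 = 0 := h.1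
  have hprod : 0 < (V 0).1 * (fderiv ℝ V 0 (1, 0)).2 := by
    rw [← (hasDerivAt_snd_axis hV.differentiableAt).deriv]
    exact h.2
  have hN : 0 < (fderiv ℝ V 0 (1, 0)).2 :=
    lt_of_le_of_ne (hc.fderiv_nonneg hV.differentiableAt hV0)
      (fun h0 => by rw [← h0, mul_zero] at hprod; exact lt_irrefl _ hprod)
  have hM : 0 < (V 0).1 := pos_of_mul_pos_left hprod hN.le
  have hang : ∀ θ, 0 < angularComp (fderiv ℝ (foldPullback V) 0) θ 1 := fun θ => by
    rw [angularComp_fderiv_foldPullback hV]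
    rcases eq_or_ne (Real.sin θ) 0 with hs | hs
    · have hcs := Real.cos_sq_add_sin_sq θ
      rw [hs] at hcs ⊢
      have : Real.cos θ ^ 2 = 1 := by linarith
      rw [this]
      linarith
    · positivity
  have hW0 : foldPullback V 0 = 0 := by
    ext
    · simp [foldPullback]
    · have e : V (0, 0) = V 0 := rfl
      simp [foldPullback, e, hV0]
  obtain ⟨φ, C, hφ, hT⟩ := exists_halfReturn hang hW hW0
  have hφneg := hφ.mono fun x h => h.1
  obtain ⟨p, hp⟩ := hT 2
  obtain ⟨-, -, hlim⟩ := taylor_of_mul_neg le_rfl hp hφneg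
  refine ⟨φ, hT, hφneg, ?_, ?_⟩
  · obtain ⟨K, r, hr, hK⟩ := hW.exists_lipschitzOnWith_ball
    filter_upwards [hφ.filter_mono nhdsGT_zero_le_nhdsNE,
      (hlim.eventually hφ).filter_mono nhdsGT_zero_le_nhdsNE,
      (hlim.eventually (eventually_mul_abs_lt C hr)).filter_mono nhdsGT_zero_le_nhdsNE,
      self_mem_nhdsWithin] with x h1 h2 h3 (h4 : 0 < x)
    obtain ⟨γ, T, hTpos, hγ, hγ0, hγT, hpos⟩ := h1.exists_trajectory
    -- The upper half turn from x to φ(x), reflected and run backwards, is a trajectory from φ(x) to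
    -- x in the lower half plane; by uniqueness φ(φ(x)) = x.
    refine (h2.eq_of_trajectory hK h3 (γ := fun t => ((γ (T - t)).1, -(γ (T - t)).2)) hTpos
      ?_ (by simp [hγT]) (by simp [hγ0]) fun t ht => ?_).symm
    · intro t ht
      have hmaps : Set.MapsTo (fun t => T - t) (Set.Icc 0 T) (Set.Icc 0 T) := fun q hq =>
        ⟨by linarith [hq.2], by linarith [hq.1]⟩
      have h5 : HasDerivWithinAt (fun t => T - t) (-1) (Set.Icc 0 T) t := by
        simpa using (hasDerivWithinAt_id t (Set.Icc 0 T)).const_sub T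
      have h6 := (hγ (T - t) (hmaps ht)).scomp t h5 hmaps
      refine (HasDerivWithinAt.prodMk h6.fst_snd.1 h6.fst_snd.2.neg).congr_deriv ?_
      rw [foldPullback_reflect V (γ (T - t))]
      simp
    · have := hpos (T - t) ⟨by linarith [ht.2], by linarith [ht.1]⟩
      have := pos_of_mul_pos_right this h4.le
      simp only [ne_eq, neg_eq_zero]
      exact this.ne'
  · obtain ⟨K, r, hr, hK⟩ := hV.exists_lipschitzOnWith_ball
    filter_upwards [hφ.filter_mono nhdsLT_zero_le_nhdsNE,
      (eventually_mul_abs_lt C hr).filter_mono nhdsLT_zero_le_nhdsNE,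
      -- With |y| < 1 squaring does not increase |y|, so the folded orbit remains in the ball where
      -- `V` is Lipschitz.
      (eventually_mul_abs_lt C one_pos).filter_mono nhdsLT_zero_le_nhdsNE,
      self_mem_nhdsWithin] with c h1 h2 h3 (h4 : c < 0) b ⟨γ, T, hTpos, hγ, hγ0, hγT, hneg⟩
    obtain ⟨-, Γ, g, τ, hτ, hΓ, hg, hΓ0, hΓτ, hpos, hbd⟩ := h1
    have hS : ∀ s ∈ Set.Ioo 0 τ, (Γ s).2 < 0 := fun s hs => neg_of_mul_pos_right (hpos s hs) h4.le
    have hΓc : ContinuousOn Γ (Set.Icc 0 τ) := fun s hs => (hΓ.hasDeriv s hs).continuousWithinAt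
    -- The fold maps the orbit to an orbit of `V` in the lower half plane, with speed factor
    -- multiplied by -2y: positive inside, zero at both ends.
    have horb : IsOrbit V (fun s => ((Γ s).1, -(Γ s).2 ^ 2)) (fun s => g s * (-2 * (Γ s).2)) τ := by
      refine ⟨hΓ.continuousOn.mul (continuousOn_const.mul hΓc.snd), fun s hs => ?_,
        fun s hs => ?_⟩
      · exact mul_pos (hΓ.pos s hs) (by linarith [hS s hs])
      · have h5 := hΓ.hasDeriv s hs
        refine (HasDerivWithinAt.prodMk h5.fst_snd.1 (h5.fst_snd.2.pow 2).neg).congr_deriv ?_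
        ext
        · simp [foldPullback]
          ring
        · simp [foldPullback]
          ring
    have := horb.eq_of_trajectory hτ Metric.isOpen_ball hK (σ := -1) (fun s hs => ?_)
      (fun s hs => ?_) (by simp [hΓτ]) hTpos hγ (by simp [hγ0, hΓ0]) (by simp [hγT])
      (fun t ht => (hneg t ht).ne)
    · simpa [hγT, hΓτ] using this
    · have h6 := hbd s hs
      have h7 : |(Γ s).2| ≤ C * |c| := (norm_snd_le (Γ s)).trans h6
      have h8 : |(Γ s).1| ≤ C * |c| := (norm_fst_le (Γ s)).trans h6
      rw [mem_ball_zero_iff, Prod.norm_mk, Real.norm_eq_abs, Real.norm_eq_abs, abs_neg, abs_pow]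
      refine max_lt (h8.trans_lt h2) ?_
      have h9 := abs_nonneg (Γ s).2
      nlinarith
    · have := hS s hs
      have : 0 < (Γ s).2 ^ 2 := by nlinarith
      simpa using this

theorem order_of_hasPseudoFocusOfOrder {V₁ V₂ : ℝ × ℝ → ℝ × ℝ} {k n : ℕ} (hn : 1 ≤ n)
    (hV₁ : AnalyticAt ℝ V₁ 0) (hV₂ : AnalyticAt ℝ V₂ 0) (hF : HasFocusOfOrder V₁ k)
    (h₂ : HasParabolicContact V₂ ∨ HasCenter V₂) (hP : HasPseudoFocusOfOrder V₁ V₂ n) :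
    n = 2 * k + 1 ∨ (Even n ∧ n < 2 * k + 1) := by
  obtain ⟨hc₁, hc₂, P, hP, α, hα, hPα⟩ := hP
  obtain ⟨hm, F, hF, β, hβ, hFβ⟩ := hF
  obtain ⟨φ₁, C, hφ₁, hT₁⟩ := exists_halfReturn
    (angularComp_fderiv_pos hm hV₁.differentiableAt hc₁) hV₁ hm.1
  obtain ⟨φ₂, hφ₂⟩ : ∃ φ, IsLowerInvolution V₂ φ :=
    h₂.elim (fun h => h.exists_isLowerInvolution hV₂ hc₂)
      (fun h => h.exists_isLowerInvolution hV₂ hc₂)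
  have hs₁ := hφ₁.mono fun x h => h.1
  obtain ⟨K, r, hr, hK⟩ := hV₁.exists_lipschitzOnWith_ball
  obtain ⟨p, hp⟩ := hT₁ 2
  obtain ⟨-, -, hlim⟩ := taylor_of_mul_neg le_rfl hp hs₁
  have hlim' : Tendsto φ₁ (𝓝[>] 0) (𝓝[<] 0) := by
    refine tendsto_nhdsWithin_iff.2 ⟨(hlim.mono_left nhdsGT_zero_le_nhdsNE).mono_right
      nhdsWithin_le_nhds, ?_⟩
    filter_upwards [hs₁.filter_mono nhdsGT_zero_le_nhdsNE, self_mem_nhdsWithin]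
      with x h1 (h2 : 0 < x)
    exact neg_of_mul_neg_right h1 h2.le
  refine order_of_involution_comp hT₁ hφ₂.taylor hs₁ hφ₂.mul_neg hφ₂.invol hn hα hβ
    (hPα.congr' ?_ EventuallyEq.rfl) (hFβ.congr' ?_ EventuallyEq.rfl)
  · filter_upwards [hP, hφ₁.filter_mono nhdsGT_zero_le_nhdsNE,
      (eventually_mul_abs_lt C hr).filter_mono nhdsGT_zero_le_nhdsNE,
      hlim'.eventually hφ₂.transition] with x ⟨_, _, c, _, hup, hlow⟩ h2 h3 h4
    obtain rfl := h2.eq_of_upperTransition hK h3 hup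
    rw [h4 _ hlow]
  · filter_upwards [hF, eventually_firstReturn_eq hV₁ hφ₁ hT₁] with x h1 h2
    rw [h2 _ h1]

end Monodromic

/-! ### An explicit focus of each order. -/

section RadialGrowth

/-- The field `-y ∂ₓ + x ∂_y + (x² + y²)ᵏ (x ∂ₓ + y ∂_y)`, with a focus of order `k`. -/
def standardFocus (k : ℕ) (z : ℝ × ℝ) : ℝ × ℝ :=
  (-z.2 + z.1 * (z.1 ^ 2 + z.2 ^ 2) ^ k, z.1 + z.2 * (z.1 ^ 2 + z.2 ^ 2) ^ k)

theorem analyticAt_standardFocus (k : ℕ) : AnalyticAt ℝ (standardFocus k) 0 := by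
  have h : AnalyticAt ℝ (fun z : ℝ × ℝ => (z.1 ^ 2 + z.2 ^ 2) ^ k) 0 :=
    ((analyticAt_fst.pow 2).add (analyticAt_snd.pow 2)).pow k
  exact (analyticAt_snd.neg.add (analyticAt_fst.mul h)).prod
    (analyticAt_fst.add (analyticAt_snd.mul h))

theorem fderiv_standardFocus_zero (k : ℕ) (v : ℝ × ℝ) :
    fderiv ℝ (standardFocus k) 0 v = (-v.2 + v.1 * 0 ^ k, v.1 + v.2 * 0 ^ k) := by
  have hline : HasDerivAt (fun t : ℝ => t • v) v 0 := by
    simpa using (hasDerivAt_id (0 : ℝ)).smul_const v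
  have hW : HasFDerivAt (standardFocus k) (fderiv ℝ (standardFocus k) 0) ((0 : ℝ) • v) := by
    rw [zero_smul]
    exact (analyticAt_standardFocus k).differentiableAt.hasFDerivAt
  have h1 := hW.comp_hasDerivAt (0 : ℝ) hline
  have hlin : ∀ c : ℝ, HasDerivAt (fun t : ℝ => t * c) c 0 := fun c => by
    simpa using (hasDerivAt_id (0 : ℝ)).mul_const c
  have hr : HasDerivAt (fun t : ℝ => ((t * v.1) ^ 2 + (t * v.2) ^ 2) ^ k)
      (deriv (fun t : ℝ => ((t * v.1) ^ 2 + (t * v.2) ^ 2) ^ k) 0) 0 :=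
    DifferentiableAt.hasDerivAt (by fun_prop)
  have h2 := HasDerivAt.prodMk ((hlin v.2).neg.add ((hlin v.1).mul hr))
    ((hlin v.1).add ((hlin v.2).mul hr))
  have h3 := h1.unique h2
  rw [h3]
  simp

theorem hasNondegenerateMonodromicSingularity_standardFocus (k : ℕ) :
    HasNondegenerateMonodromicSingularity (standardFocus k) := by
  refine ⟨by ext <;> simp [standardFocus], fun z hz him => ?_⟩
  set L : ℝ × ℝ →ₗ[ℝ] ℝ × ℝ := (fderiv ℝ (standardFocus k) 0 : ℝ × ℝ →ₗ[ℝ] ℝ × ℝ) with hL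
  have hzre : z = algebraMap ℝ ℂ z.re := by
    apply Complex.ext <;> simp [him]
  rw [hzre, Polynomial.aeval_algebraMap_apply, Polynomial.coe_aeval_eq_eval] at hz
  have hroot : L.charpoly.IsRoot z.re := by simpa using hz
  obtain ⟨v, hv⟩ := ((Module.End.hasEigenvalue_iff_isRoot_charpoly L z.re).2
    hroot).exists_hasEigenvector
  have hLv : L v = z.re • v := hv.apply_eq_smul
  have hLv' : L v = (-v.2 + v.1 * 0 ^ k, v.1 + v.2 * 0 ^ k) := fderiv_standardFocus_zero k v
  rw [hLv', Prod.ext_iff] at hLv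
  obtain ⟨h1, h2⟩ := hLv
  simp only [Prod.smul_fst, Prod.smul_snd, smul_eq_mul] at h1 h2
  have hsum : v.1 ^ 2 + v.2 ^ 2 = 0 := by linear_combination v.1 * h2 - v.2 * h1
  refine hv.2 (Prod.ext ?_ ?_)
  · exact pow_eq_zero_iff two_ne_zero |>.1 (by nlinarith [sq_nonneg v.1, sq_nonneg v.2])
  · exact pow_eq_zero_iff two_ne_zero |>.1 (by nlinarith [sq_nonneg v.1, sq_nonneg v.2])

theorem crossesCounterclockwise_standardFocus (k : ℕ) :
    CrossesCounterclockwise (standardFocus k) :=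
  Eventually.of_forall fun x => by simp [standardFocus]

/-- Solutions of `r' = r^(2k+1)` and the expansion of their time-`t` maps. -/
theorem exists_radial_solution (k : ℕ) (T : ℝ) : ∃ R : ℝ → ℝ → ℝ,
    (∀ᶠ x in 𝓝[>] (0 : ℝ), R x 0 = x ∧
      ∀ t ∈ Set.Icc 0 T, 0 < R x t ∧ HasDerivAt (R x) (R x t ^ (2 * k + 1)) t) ∧
    ∀ t > 0, ∃ α : ℝ, α ≠ 0 ∧
      (fun x => R x t - x - α * x ^ (2 * k + 1)) =o[𝓝[>] 0] fun x => x ^ (2 * k + 1) := by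
  rcases Nat.eq_zero_or_pos k with rfl | hk
  · refine ⟨fun x t => x * Real.exp t, ?_, fun t ht => ⟨Real.exp t - 1, ?_, ?_⟩⟩
    · filter_upwards [self_mem_nhdsWithin] with x (hx : 0 < x)
      refine ⟨by simp, fun t _ => ⟨mul_pos hx (Real.exp_pos t), ?_⟩⟩
      simpa using (Real.hasDerivAt_exp t).const_mul x
    · exact sub_ne_zero.2 (Real.one_lt_exp_iff.2 ht).ne'
    · refine (isLittleO_zero _ _).congr_left fun x => ?_
      ring
  have hk0 : (0 : ℝ) < 2 * k := by positivity
  set p : ℝ := -(1 / (2 * k : ℝ)) with hp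
  -- Separation of variables: r^(-2k) decreases at the constant rate 2k.
  refine ⟨fun x t => x * (1 - 2 * k * x ^ (2 * k) * t) ^ p, ?_, fun t ht => ⟨t, ht.ne', ?_⟩⟩
  · have hlim : Tendsto (fun x : ℝ => 2 * k * x ^ (2 * k) * T) (𝓝[>] 0) (𝓝 0) := by
      have : Continuous fun x : ℝ => 2 * (k : ℝ) * x ^ (2 * k) * T := by fun_prop
      exact (this.tendsto' 0 0 (by simp [hk.ne'])).mono_left nhdsWithin_le_nhds
    filter_upwards [hlim.eventually_lt_const one_pos, self_mem_nhdsWithin] with x h1 (hx : 0 < x)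
    refine ⟨by simp, fun t ht => ?_⟩
    have hw : 0 < 1 - 2 * k * x ^ (2 * k) * t := by
      have := mul_le_mul_of_nonneg_left ht.2 (show 0 ≤ 2 * (k : ℝ) * x ^ (2 * k) by positivity)
      linarith
    refine ⟨mul_pos hx (Real.rpow_pos_of_pos hw p), ?_⟩
    have hd : HasDerivAt (fun t : ℝ => 1 - 2 * k * x ^ (2 * k) * t)
        (-(2 * k * x ^ (2 * k) * 1)) t :=
      ((hasDerivAt_id t).const_mul (2 * (k : ℝ) * x ^ (2 * k))).const_sub 1
    have h2 := (hd.rpow_const (p := p) (Or.inl hw.ne')).const_mul x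
    refine h2.congr_deriv ?_
    have e1 : p - 1 = p * ((2 * k + 1 : ℕ) : ℝ) := by
      rw [hp]
      push_cast
      field_simp
      ring
    rw [e1, Real.rpow_mul_natCast hw.le, mul_pow, hp]
    field_simp
    ring
  · have hd : HasDerivAt (fun s : ℝ => 1 - 2 * k * s * t) (-(2 * k * 1 * t)) 0 :=
      (((hasDerivAt_id (0 : ℝ)).const_mul (2 * (k : ℝ))).mul_const t).const_sub 1
    have h2 := hd.rpow_const (p := p) (Or.inl (by simp))
    have h3 : HasDerivAt (fun s : ℝ => (1 - 2 * k * s * t) ^ p) t 0 := by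
      refine h2.congr_deriv ?_
      simp only [mul_zero, zero_mul, sub_zero, Real.one_rpow, hp]
      field_simp
    have h4 := hasDerivAt_iff_isLittleO.1 h3
    simp only [mul_zero, zero_mul, sub_zero, Real.one_rpow, smul_eq_mul] at h4
    have hlim : Tendsto (fun x : ℝ => x ^ (2 * k)) (𝓝[>] 0) (𝓝 0) :=
      ((continuous_pow (2 * k)).tendsto' 0 0 (by simp [hk.ne'])).mono_left nhdsWithin_le_nhds
    -- The derivative of (1 - 2kst)^p at s = 0 is t; putting s = x^(2k) and multiplying by x gives
    -- the coefficient of x^(2k+1).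
    have h5 := (isBigO_refl (fun x : ℝ => x) (𝓝[>] 0)).mul_isLittleO (h4.comp_tendsto hlim)
    refine h5.congr (fun x => ?_) fun x => ?_
    · simp only [Function.comp_apply]
      ring
    · simp only [Function.comp_apply]
      ring

variable {k : ℕ} {R : ℝ → ℝ} {T : ℝ}

theorem isTrajectory_standardFocus (hR : ∀ t ∈ Set.Icc 0 T, HasDerivAt R (R t ^ (2 * k + 1)) t) :
    IsTrajectory (standardFocus k) (fun t => (R t * Real.cos t, R t * Real.sin t)) T := by
  intro t ht
  have h := HasDerivAt.prodMk ((hR t ht).mul (Real.hasDerivAt_cos t))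
    ((hR t ht).mul (Real.hasDerivAt_sin t))
  refine h.hasDerivWithinAt.congr_deriv ?_
  have e : (R t * Real.cos t) ^ 2 + (R t * Real.sin t) ^ 2 = R t ^ 2 := by
    linear_combination R t ^ 2 * Real.cos_sq_add_sin_sq t
  simp only [standardFocus, e]
  ext
  · simp only
    ring
  · simp only
    ring

theorem upperTransition_standardFocus
    (hR : ∀ t ∈ Set.Icc 0 Real.pi, 0 < R t ∧ HasDerivAt R (R t ^ (2 * k + 1)) t) :
    UpperTransition (standardFocus k) (R 0) (-R Real.pi) := by
  refine ⟨_, Real.pi, Real.pi_pos, isTrajectory_standardFocus fun t ht => (hR t ht).2,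
    by simp, by simp, fun t ht => ?_⟩
  exact mul_pos (hR t ⟨ht.1.le, ht.2.le⟩).1 (Real.sin_pos_of_pos_of_lt_pi ht.1 ht.2)

theorem firstReturn_standardFocus
    (hR : ∀ t ∈ Set.Icc 0 (2 * Real.pi), 0 < R t ∧ HasDerivAt R (R t ^ (2 * k + 1)) t) :
    FirstReturn (standardFocus k) (R 0) (R (2 * Real.pi)) := by
  have hπ := Real.two_pi_pos
  refine ⟨(hR 0 ⟨le_rfl, hπ.le⟩).1, (hR _ ⟨hπ.le, le_rfl⟩).1, _, 2 * Real.pi, hπ,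
    isTrajectory_standardFocus fun t ht => (hR t ht).2, by simp, by simp, ?_⟩
  rintro t ht ⟨h1, h2⟩
  have hRt := (hR t ⟨ht.1.le, ht.2.le⟩).1
  have hcos : 0 < Real.cos t := pos_of_mul_pos_right h1 hRt.le
  have hsin : Real.sin t = 0 := (mul_eq_zero.1 h2).resolve_left hRt.ne'
  have hcs := Real.cos_sq_add_sin_sq t
  rw [hsin] at hcs
  have hone : Real.cos t = 1 := by nlinarith
  have := (Real.cos_eq_one_iff_of_lt_of_lt (by linarith [ht.1]) ht.2).1 hone
  exact ht.1.ne' this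

theorem hasFocusOfOrder_standardFocus (k : ℕ) : HasFocusOfOrder (standardFocus k) k := by
  refine ⟨hasNondegenerateMonodromicSingularity_standardFocus k, ?_⟩
  obtain ⟨R, hR, hα⟩ := exists_radial_solution k (2 * Real.pi)
  refine ⟨fun x => R x (2 * Real.pi), ?_, hα _ Real.two_pi_pos⟩
  filter_upwards [hR] with x ⟨h0, h1⟩
  have := firstReturn_standardFocus (k := k) h1
  rwa [h0] at this

end RadialGrowth

/-! ### Explicit parabolic contacts and their involutions. -/

section Contact

/-- The field `∂ₓ + (2x + e (m+1) xᵐ) ∂_y`, with first integral `y - x² - e x^(m+1)`. -/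
def parabolicField (e : ℝ) (m : ℕ) (z : ℝ × ℝ) : ℝ × ℝ := (1, 2 * z.1 + e * (m + 1) * z.1 ^ m)

variable {e : ℝ} {m : ℕ}

theorem analyticAt_parabolicField (e : ℝ) (m : ℕ) : AnalyticAt ℝ (parabolicField e m) 0 :=
  analyticAt_const.prod ((analyticAt_const.mul analyticAt_fst).add
    (analyticAt_const.mul (analyticAt_fst.pow m)))

theorem hasParabolicContact_parabolicField (e : ℝ) (hm : 2 ≤ m) :
    HasParabolicContact (parabolicField e m) := by
  have hd : HasDerivAt (fun x : ℝ => 2 * x + e * (m + 1) * x ^ m)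
      (2 * 1 + e * (m + 1) * (m * 0 ^ (m - 1))) 0 :=
    ((hasDerivAt_id (0 : ℝ)).const_mul 2).add ((hasDerivAt_pow m 0).const_mul _)
  refine ⟨by simp [parabolicField, show m ≠ 0 by omega], ?_⟩
  simp only [parabolicField]
  rw [hd.deriv, zero_pow (by omega)]
  norm_num

theorem eventually_pos_parabolicField (e : ℝ) (hm : 2 ≤ m) :
    ∀ᶠ x in 𝓝 (0 : ℝ), 0 < 2 + e * (m + 1) * x ^ (m - 1) := by
  have hc : Continuous fun x : ℝ => 2 + e * (m + 1) * x ^ (m - 1) := by fun_prop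
  exact (hc.tendsto' 0 2 (by simp [show m - 1 ≠ 0 by omega])).eventually_const_lt two_pos

theorem parabolicField_snd_eq (e : ℝ) (hm : 2 ≤ m) (x : ℝ) :
    2 * x + e * (m + 1) * x ^ m = x * (2 + e * (m + 1) * x ^ (m - 1)) := by
  obtain ⟨j, rfl⟩ := Nat.exists_eq_add_of_le' hm
  simp only [Nat.add_succ_sub_one]
  ring

theorem crossesCounterclockwise_parabolicField (e : ℝ) (hm : 2 ≤ m) :
    CrossesCounterclockwise (parabolicField e m) := by
  filter_upwards [(eventually_pos_parabolicField e hm).filter_mono nhdsWithin_le_nhds] with x hx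
  simp only [parabolicField]
  rw [parabolicField_snd_eq e hm, sign_mul, sign_pos hx, mul_one]

/-- With G(x) = x² + e x^(m+1) the trajectory from (-s, 0) is the graph of G - G(-s), which returns
to the axis where G(b) = G(-s). As m + 1 is odd and e ≥ 0, G(-s) ≤ G(s), so b lies in (0, s];
monotonicity of G on each side keeps the graph below the axis in between. -/
theorem exists_lowerTransition_parabolicField (hm : 2 ≤ m) (hme : Even m) (he : 0 ≤ e) :
    ∃ B : ℝ → ℝ, ∀ᶠ s in 𝓝[>] (0 : ℝ), 0 < B s ∧ B s ≤ s ∧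
      B s ^ 2 + e * B s ^ (m + 1) = s ^ 2 - e * s ^ (m + 1) ∧
      LowerTransition (parabolicField e m) (-s) (B s) := by
  suffices h : ∀ᶠ s in 𝓝[>] (0 : ℝ), ∃ b, 0 < b ∧ b ≤ s ∧
      b ^ 2 + e * b ^ (m + 1) = s ^ 2 - e * s ^ (m + 1) ∧
      LowerTransition (parabolicField e m) (-s) b by
    exact h.choice
  obtain ⟨δ, hδ, hball⟩ := Metric.eventually_nhds_iff_ball.1 (eventually_pos_parabolicField e hm)
  set G : ℝ → ℝ := fun x => x ^ 2 + e * x ^ (m + 1) with hG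
  have hGd : ∀ x, HasDerivAt G (x * (2 + e * (m + 1) * x ^ (m - 1))) x := fun x => by
    have := (hasDerivAt_pow 2 x).add ((hasDerivAt_pow (m + 1) x).const_mul e)
    refine this.congr_deriv ?_
    rw [← parabolicField_snd_eq e hm]
    push_cast
    ring
  have hGc : Continuous G := continuous_iff_continuousAt.2 fun x => (hGd x).continuousAt
  have hmono : StrictMonoOn G (Set.Ico 0 δ) := by
    refine strictMonoOn_of_deriv_pos (convex_Ico 0 δ) hGc.continuousOn fun x hx => ?_
    rw [interior_Ico] at hx
    rw [(hGd x).deriv]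
    refine mul_pos hx.1 (hball x ?_)
    rw [mem_ball_zero_iff, Real.norm_eq_abs, abs_of_pos hx.1]
    exact hx.2
  have hanti : StrictAntiOn G (Set.Ioc (-δ) 0) := by
    refine strictAntiOn_of_deriv_neg (convex_Ioc (-δ) 0) hGc.continuousOn fun x hx => ?_
    rw [interior_Ioc] at hx
    rw [(hGd x).deriv]
    refine mul_neg_of_neg_of_pos hx.2 (hball x ?_)
    rw [mem_ball_zero_iff, Real.norm_eq_abs, abs_of_neg hx.2]
    linarith [hx.1]
  have hG0 : G 0 = 0 := by simp [hG]
  have hGneg : ∀ s, G (-s) = s ^ 2 - e * s ^ (m + 1) := fun s => by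
    simp only [hG]
    rw [hme.add_one.neg_pow]
    ring
  filter_upwards [Ioo_mem_nhdsGT hδ] with s hs
  have hsneg : -s ∈ Set.Ioc (-δ) 0 := ⟨by linarith [hs.2], by linarith [hs.1]⟩
  have h0neg : (0 : ℝ) ∈ Set.Ioc (-δ) 0 := ⟨by linarith, le_rfl⟩
  have hpos : 0 < G (-s) := by
    rw [← hG0]
    exact hanti hsneg h0neg (by linarith [hs.1])
  have hle : G (-s) ≤ G s := by
    rw [hGneg]
    simp only [hG]
    have := mul_nonneg he (pow_nonneg hs.1.le (m + 1))
    linarith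
  obtain ⟨b, hb, hGb⟩ := intermediate_value_Icc hs.1.le hGc.continuousOn
    (show G (-s) ∈ Set.Icc (G 0) (G s) from ⟨by rw [hG0]; exact hpos.le, hle⟩)
  have hb0 : 0 < b := lt_of_le_of_ne hb.1 (by rintro rfl; rw [hG0] at hGb; exact hpos.ne hGb)
  refine ⟨b, hb0, hb.2, hGb.trans (hGneg s), fun t => (-s + t, G (-s + t) - G (-s)), b + s,
    by linarith [hs.1], fun t _ => ?_, by simp, by simp [hGb], fun t ht => ?_⟩
  · have h1 : HasDerivAt (fun t : ℝ => -s + t) 1 t := (hasDerivAt_id t).const_add (-s)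
    have h2 := ((hGd (-s + t)).comp t h1).sub_const (G (-s))
    refine (h1.prodMk h2).hasDerivWithinAt.congr_deriv ?_
    simp only [parabolicField, mul_one]
    rw [parabolicField_snd_eq e hm]
  · refine sub_neg.2 ?_
    rcases le_or_gt (-s + t) 0 with h | h
    · exact hanti hsneg ⟨by linarith [ht.1, hs.2], h⟩ (by linarith [ht.1])
    · rw [← hGb]
      exact hmono ⟨h.le, by linarith [ht.2, hb.2, hs.2]⟩ ⟨hb0.le, by linarith [hb.2, hs.2]⟩
        (by linarith [ht.2])

/-- With q = B/s the equation reads q² = 1 - e s^(m-1) (q^(m+1) + 1). Boundedness of q gives q → 1,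
and factoring q² - 1 then gives (q - 1)/s^(m-1) → -e. -/
theorem isLittleO_of_involution_eq (hm : 2 ≤ m) {B : ℝ → ℝ}
    (hB : ∀ᶠ s in 𝓝[>] (0 : ℝ), 0 < B s ∧ B s ≤ s ∧
      B s ^ 2 + e * B s ^ (m + 1) = s ^ 2 - e * s ^ (m + 1)) :
    (fun s => B s - s + e * s ^ m) =o[𝓝[>] 0] fun s => s ^ m := by
  set q : ℝ → ℝ := fun s => B s / s with hq
  have hqI : ∀ᶠ s in 𝓝[>] (0 : ℝ), q s ∈ Set.Icc 0 1 := by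
    filter_upwards [hB, self_mem_nhdsWithin] with s h1 (hs : 0 < s)
    exact ⟨div_nonneg h1.1.le hs.le, (div_le_one hs).2 h1.2.1⟩
  have hs1 : Tendsto (fun s : ℝ => s ^ (m - 1)) (𝓝[>] 0) (𝓝 0) :=
    ((continuous_pow (m - 1)).tendsto' 0 0
      (by simp [show m - 1 ≠ 0 by omega])).mono_left nhdsWithin_le_nhds
  have hsq : Tendsto (fun s => q s ^ 2) (𝓝[>] 0) (𝓝 1) := by
    have hbd : Tendsto (fun s => s ^ (m - 1) * (e * (q s ^ (m + 1) + 1))) (𝓝[>] 0) (𝓝 0) := by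
      refine hs1.zero_mul_isBoundedUnder_le ?_
      refine isBoundedUnder_of_eventually_le (a := |e| * 2) ?_
      filter_upwards [hqI] with s hs
      simp only [Function.comp_apply, Real.norm_eq_abs]
      rw [abs_mul]
      refine mul_le_mul_of_nonneg_left ?_ (abs_nonneg e)
      rw [abs_of_nonneg (by have := pow_nonneg hs.1 (m + 1); linarith)]
      linarith [pow_le_one₀ hs.1 hs.2 (n := m + 1)]
    have := hbd.const_sub 1
    rw [sub_zero] at this
    refine this.congr' ?_
    filter_upwards [hB, self_mem_nhdsWithin] with s h1 (hs : 0 < s)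
    obtain ⟨j, rfl⟩ := Nat.exists_eq_add_of_le' hm
    have hBs : B s = q s * s := by rw [hq, div_mul_cancel₀ _ hs.ne']
    have h3 := h1.2.2
    rw [hBs] at h3
    refine mul_left_cancel₀ (pow_ne_zero 2 hs.ne') ?_
    simp only [Nat.add_succ_sub_one]
    linear_combination -h3
  have hq1 : Tendsto q (𝓝[>] 0) (𝓝 1) := by
    have h := hsq.sqrt
    rw [Real.sqrt_one] at h
    refine h.congr' ?_
    filter_upwards [hqI] with s hs
    exact Real.sqrt_sq hs.1
  have hlim : Tendsto (fun s => -(e * (q s ^ (m + 1) + 1)) / (q s + 1) + e) (𝓝[>] 0) (𝓝 0) := by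
    have := ((((hq1.pow (m + 1)).add_const 1).const_mul e).neg.div (hq1.add_const 1)
      (by norm_num)).add_const e
    convert this using 2
    norm_num
    ring
  rw [isLittleO_iff_tendsto' (by
    filter_upwards [self_mem_nhdsWithin] with s (hs : 0 < s) h
    exact absurd h (pow_ne_zero _ hs.ne'))]
  refine hlim.congr' ?_
  filter_upwards [hB, hqI, self_mem_nhdsWithin] with s h1 h2 (hs : 0 < s)
  have hBs : B s = q s * s := by rw [hq, div_mul_cancel₀ _ hs.ne']
  have h3 := h1.2.2
  rw [hBs] at h3 ⊢
  have hq0 : q s + 1 ≠ 0 := by linarith [h2.1]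
  have h4 : (q s - 1) * (q s + 1) * s = -(e * (q s ^ (m + 1) + 1)) * s ^ m := by
    have : s * ((q s - 1) * (q s + 1) * s) = s * (-(e * (q s ^ (m + 1) + 1)) * s ^ m) := by
      rw [mul_pow, mul_pow] at h3
      linear_combination h3
    exact mul_left_cancel₀ hs.ne' this
  field_simp
  linear_combination -h4

end Contact

/-! ### Realization of the admissible orders and the conclusion. -/

theorem exists_hasPseudoFocusOfOrder {k n : ℕ} (hn : 1 ≤ n)
    (h : n = 2 * k + 1 ∨ (Even n ∧ n < 2 * k + 1)) :
    ∃ V₁ V₂ : ℝ × ℝ → ℝ × ℝ, AnalyticAt ℝ V₁ 0 ∧ AnalyticAt ℝ V₂ 0 ∧ HasFocusOfOrder V₁ k ∧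
      (HasParabolicContact V₂ ∨ HasCenter V₂) ∧ HasPseudoFocusOfOrder V₁ V₂ n := by
  obtain ⟨e, m, hm, hme, he, hcase⟩ : ∃ (e : ℝ) (m : ℕ), 2 ≤ m ∧ Even m ∧ 0 ≤ e ∧
      ((e = 0 ∧ n = 2 * k + 1) ∨ (e = 1 ∧ n = m ∧ n < 2 * k + 1)) := by
    rcases h with h | ⟨h1, h2⟩
    -- With e = 0 the involution is x ↦ -x and the exponent is immaterial; 2 merely meets the side
    -- conditions.
    · exact ⟨0, 2, le_rfl, even_two, le_rfl, Or.inl ⟨rfl, h⟩⟩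
    · refine ⟨1, n, ?_, h1, zero_le_one, Or.inr ⟨rfl, rfl, h2⟩⟩
      obtain ⟨j, rfl⟩ := h1
      omega
  refine ⟨standardFocus k, parabolicField e m, analyticAt_standardFocus k,
    analyticAt_parabolicField e m, hasFocusOfOrder_standardFocus k,
    Or.inl (hasParabolicContact_parabolicField e hm), crossesCounterclockwise_standardFocus k,
    crossesCounterclockwise_parabolicField e hm, ?_⟩
  obtain ⟨R, hR, hα⟩ := exists_radial_solution k Real.pi
  obtain ⟨B, hB⟩ := exists_lowerTransition_parabolicField hm hme he
  obtain ⟨α, hα0, hα⟩ := hα Real.pi Real.pi_pos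
  have hπ : Real.pi ∈ Set.Icc 0 Real.pi := ⟨Real.pi_pos.le, le_rfl⟩
  have hid : Tendsto (fun x : ℝ => x) (𝓝[>] 0) (𝓝 0) := tendsto_id.mono_left nhdsWithin_le_nhds
  have hlim : Tendsto (fun x => R x Real.pi) (𝓝[>] 0) (𝓝[>] 0) := by
    refine tendsto_nhdsWithin_iff.2 ⟨?_, hR.mono fun x h => (h.2 _ hπ).1⟩
    have h0 : Tendsto (fun x : ℝ => x ^ (2 * k + 1)) (𝓝[>] 0) (𝓝 0) := by
      simpa using hid.pow (2 * k + 1)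
    have := ((hα.trans_tendsto h0).add hid).add (h0.const_mul α)
    simp only [mul_zero, add_zero] at this
    exact this.congr fun x => by ring
  refine ⟨fun x => B (R x Real.pi), ?_, ?_⟩
  · filter_upwards [hR, hlim.eventually hB, self_mem_nhdsWithin] with x ⟨h0, h1⟩ h2 (hx : 0 < x)
    have hup := upperTransition_standardFocus (k := k) h1
    rw [h0] at hup
    exact ⟨hx, h2.1, -R x Real.pi, neg_neg_of_pos (h1 _ hπ).1, hup, h2.2.2.2⟩
  rcases hcase with ⟨rfl, rfl⟩ | ⟨rfl, rfl, hlt⟩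
  · refine ⟨α, hα0, hα.congr' ?_ EventuallyEq.rfl⟩
    filter_upwards [hR, hlim.eventually hB] with x h1 h2
    have h3 := h2.2.2.1
    simp only [zero_mul, add_zero, sub_zero] at h3
    rw [(pow_left_inj₀ h2.1.le (h1.2 _ hπ).1.le two_ne_zero).1 h3]
  -- The focus changes x only by O(x^(2k+1)) = o(xⁿ), so the displacement -xⁿ of the parabolic field
  -- dominates.
  · refine ⟨-1, by norm_num, ?_⟩
    have hpow : (fun x : ℝ => x ^ (2 * k + 1)) =o[𝓝[>] 0] fun x => x ^ n :=
      (isLittleO_pow_pow hlt).mono nhdsWithin_le_nhds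
    have hsub : (fun x => R x Real.pi - x) =o[𝓝[>] 0] fun x => x ^ n := by
      refine ((hα.trans hpow).add (hpow.const_mul_left α)).congr_left fun x => by ring
    have hequiv : (fun x => R x Real.pi) ~[𝓝[>] 0] fun x => x := by
      refine hsub.trans ?_
      have : (fun x : ℝ => x ^ n) =o[𝓝 0] fun x => x ^ 1 := isLittleO_pow_pow (by omega)
      simpa using this.mono nhdsWithin_le_nhds
    have hequiv' := hequiv.pow n
    have h1 := (isLittleO_of_involution_eq hm (hB.mono fun s h => ⟨h.1, h.2.1, h.2.2.1⟩))
    have h2 := (h1.comp_tendsto hlim).trans_isBigO hequiv'.isBigO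
    refine ((h2.sub hequiv'.isLittleO).add hsub).congr_left fun x => ?_
    simp only [Function.comp_apply, Pi.sub_apply, Pi.pow_apply]
    ring

theorem mainTheorem4 (k n : ℕ) (hn : 1 ≤ n) :
    (∃ V₁ V₂ : ℝ × ℝ → ℝ × ℝ,
      AnalyticAt ℝ V₁ 0 ∧ AnalyticAt ℝ V₂ 0 ∧
      HasFocusOfOrder V₁ k ∧
      (HasParabolicContact V₂ ∨ HasCenter V₂) ∧
      HasPseudoFocusOfOrder V₁ V₂ n) ↔
    (n = 2 * k + 1 ∨ (Even n ∧ n < 2 * k + 1)) := by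
  constructor
  · rintro ⟨V₁, V₂, hV₁, hV₂, hF, h₂, hP⟩
    exact order_of_hasPseudoFocusOfOrder hn hV₁ hV₂ hF h₂ hP
  · exact exists_hasPseudoFocusOfOrder hn
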